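/- Let $\mathcal A$ be a nonempty set of action names, let $\overline{\mathcal A}=\{\overline a\mid a\in\mathcal A\}$ be a disjoint copy of it (the co-names), put $\overline{\overline a}=a$, and let $\mathcal A_\tau=\mathcal A\cup\overline{\mathcal A}\cup\{\tau\}$, where $\tau\notin\mathcal A\cup\overline{\mathcal A}$. Let $\mathcal V$ be a countably infinite set of variables. CCS terms (of the recursion-, restriction- and relabelling-free fragment) are given by $$t ::= \mathbf 0 \mid x \mid \mu.t \mid t+t \mid t\parallel t\qquad (x\in\mathcal V,\ \mu\in\mathcal A_\tau),$$ and processes are the closed terms, i.e. those without variables. The transitions between processes are those generated by the following rules, for $\mu\in\mathcal A_\tau$ and $\alpha\in\mathcal A\cup\overline{\mathcal A}$: $\mu.p\xrightarrow{\mu}p$; if $p\xrightarrow{\mu}p'$, then $p+q\xrightarrow{\mu}p'$, $q+p\xrightarrow{\mu}p'$, $p\parallel q\xrightarrow{\mu}p'\parallel q$ and $q\parallel p\xrightarrow{\mu}q\parallel p'$; if $p\xrightarrow{\alpha}p'$ and $q\xrightarrow{\overline\alpha}q'$, then $p\parallel q\xrightarrow{\tau}p'\parallel q'$. Let $\xrightarrow{\varepsilon}$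 be the reflexive and transitive closure of $\xrightarrow{\tau}$, and write $p\xRightarrow{\hat\mu}q$ if $p\xrightarrow{\varepsilon}\xrightarrow{\mu}\xrightarrow{\varepsilon}q$. Weak bisimilarity $\sim_{\mathtt{WB}}$ is the largest symmetric relation on processes such that, whenever $p\sim_{\mathtt{WB}}q$ and $p\xrightarrow{\mu}p'$, there is a process $q'$ with $p'\sim_{\mathtt{WB}}q'$ and either $q\xRightarrow{\hat\mu}q'$, or $\mu=\tau$ and $q\xrightarrow{\varepsilon}q'$. Rooted weak bisimilarity (observational congruence) is the relation with $p\sim_{\mathtt{RWB}}q$ if and only if every transition $p\xrightarrow{\mu}p'$ is matched by some $q\xRightarrow{\hat\mu}q'$ with $p'\sim_{\mathtt{WB}}q'$, and every transition $q\xrightarrow{\mu}q'$ is matched by some $p\xRightarrow{\hat\mu}p'$ with $q'\sim_{\mathtt{WB}}p'$. An equation $t\approx u$ between terms is sound if $\sigma(t)\sim_{\mathtt{RWB}}\sigma(u)$ for every substitution $\sigma$ of processes for variables. A set $\mathcal E$ of equations is sound if all its equations are sound, and complete if every sound equation between (possibly open) terms is derivable from $\mathcal E$ by the rules of equational logic (reflexivity,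 symmetry, transitivity, closure under substitutions, and congruence for $\mu.\_$, $+$ and $\parallel$). **Theorem.** Rooted weak bisimilarity has no finite, sound and complete equational axiomatisation over this language: there is no finite set $\mathcal E$ of equations between terms that is both sound and complete. -/

import Mathlib

namespace CCS

universe u v w

/-- Visible actions over a set `A` of action names: names `a` and co-names `ā`. -/
inductive Label (A : Type u) : Type u
  | name (a : A)
  | coname (a : A)

/-- Complementation of visible actions, so that the complement of the complement is the identity. -/
def Label.bar {A : Type u} : Label A → Label A
  | .name a => .coname a
  | .coname a => .name a

/-- All actions: the visible ones together with the silent action `τ`. -/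
inductive Act (A : Type u) : Type u
  | vis (α : Label A)
  | tau

/-- Terms of recursion-, restriction- and relabelling-free CCS over the action names `A`
and the variables `V`:  `t ::= 0 | x | μ.t | t + t | t ‖ t`. -/
inductive Term (A : Type u) (V : Type v) : Type (max u v)
  | nil
  | var (x : V)
  | pre (μ : Act A) (t : Term A V)
  | add (t s : Term A V)
  | par (t s : Term A V)

/-- Processes, that is closed terms: terms without variables. -/
abbrev Proc (A : Type u) : Type u := Term A Empty

/-- Substitution of terms for variables. For `W = V` this is an ordinary substitution; for
`W = Empty` it is a closed substitution. -/
def Term.subst {A : Type u} {V : Type v} {W : Type w} (σ : V → Term A W) : Term A V → Term A W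
  | .nil => .nil
  | .var x => σ x
  | .pre μ t => .pre μ (t.subst σ)
  | .add t s => .add (t.subst σ) (s.subst σ)
  | .par t s => .par (t.subst σ) (s.subst σ)

/-- The transitions between processes, generated by the SOS rules of CCS. -/
inductive Step {A : Type u} : Proc A → Act A → Proc A → Prop
  | pre (μ : Act A) (p : Proc A) : Step (.pre μ p) μ p
  | addLeft {μ : Act A} {p p' : Proc A} (q : Proc A) (h : Step p μ p') : Step (.add p q) μ p'
  | addRight {μ : Act A} {q q' : Proc A} (p : Proc A) (h : Step q μ q') : Step (.add p q) μ q'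
  | parLeft {μ : Act A} {p p' : Proc A} (q : Proc A) (h : Step p μ p') :
      Step (.par p q) μ (.par p' q)
  | parRight {μ : Act A} {q q' : Proc A} (p : Proc A) (h : Step q μ q') :
      Step (.par p q) μ (.par p q')
  | comm {α : Label A} {p p' q q' : Proc A}
      (hp : Step p (.vis α) p') (hq : Step q (.vis α.bar) q') :
      Step (.par p q) .tau (.par p' q')

/-- Finitely many (possibly zero) silent steps. -/
def Silent {A : Type u} : Proc A → Proc A → Prop :=
  Relation.ReflTransGen fun p q => Step p .tau q

/-- The strict weak transition: a `μ`-step (an actual one, also for `μ = τ`), preceded and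
followed by finitely many silent steps. -/
def StrictWeakStep {A : Type u} (p : Proc A) (μ : Act A) (q : Proc A) : Prop :=
  ∃ r s, Silent p r ∧ Step r μ s ∧ Silent s q

/-- A weak bisimulation: a symmetric relation `R` such that, if `R p q`, then each step
`p -μ→ p'` is matched either by `q` idling, if `μ = τ`, or by a weak `μ`-transition of `q`, where
a weak `τ`-transition is a possibly empty sequence of silent steps. -/
structure IsWeakBisimulation {A : Type u} (R : Proc A → Proc A → Prop) : Prop where
  symm : ∀ p q, R p q → R q p
  tau : ∀ p q p', R p q → Step p .tau p' → R p' q ∨ ∃ q', Silent q q' ∧ R p' q'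
  vis : ∀ p q α p', R p q → Step p (.vis α) p' → ∃ q', StrictWeakStep q (.vis α) q' ∧ R p' q'

/-- Weak bisimilarity: the union of all weak bisimulations, which is the largest one. -/
def WeakBisimilar {A : Type u} (p q : Proc A) : Prop :=
  ∃ R : Proc A → Proc A → Prop, IsWeakBisimulation R ∧ R p q

/-- Rooted weak bisimilarity (observational congruence): each initial step of either process,
also a silent one, is matched by a strict weak transition of the other one, up to weak
bisimilarity. -/
def RootedWeakBisimilar {A : Type u} (p q : Proc A) : Prop :=
  (∀ μ p', Step p μ p' → ∃ q', StrictWeakStep q μ q' ∧ WeakBisimilar p' q') ∧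
  (∀ μ q', Step q μ q' → ∃ p', StrictWeakStep p μ p' ∧ WeakBisimilar q' p')

/-- An equation `t ≈ s`, as a pair of terms. -/
abbrev Equation (A : Type u) (V : Type v) := Term A V × Term A V

/-- `Derivable E t s`: the equation `t ≈ s` is derivable from the axiom system `E` by the rules
of equational logic. -/
inductive Derivable {A : Type u} {V : Type v} (E : Set (Equation A V)) :
    Term A V → Term A V → Prop
  | ax {t s : Term A V} (h : (t, s) ∈ E) : Derivable E t s
  | refl (t : Term A V) : Derivable E t t
  | symm {t s : Term A V} (h : Derivable E t s) : Derivable E s t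
  | trans {t s r : Term A V} (h₁ : Derivable E t s) (h₂ : Derivable E s r) : Derivable E t r
  | subst {t s : Term A V} (σ : V → Term A V) (h : Derivable E t s) :
      Derivable E (t.subst σ) (s.subst σ)
  | pre {t s : Term A V} (μ : Act A) (h : Derivable E t s) : Derivable E (.pre μ t) (.pre μ s)
  | add {t s t' s' : Term A V} (h : Derivable E t s) (h' : Derivable E t' s') :
      Derivable E (.add t t') (.add s s')
  | par {t s t' s' : Term A V} (h : Derivable E t s) (h' : Derivable E t' s') :
      Derivable E (.par t t') (.par s s')

/-- The equation `t ≈ s` is sound modulo rooted weak bisimilarity: all its closed instances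
hold. -/
def SoundEquation {A : Type u} {V : Type v} (t s : Term A V) : Prop :=
  ∀ σ : V → Proc A, RootedWeakBisimilar (t.subst σ) (s.subst σ)

/-- All axioms of `E` are sound modulo rooted weak bisimilarity. -/
def Sound {A : Type u} {V : Type v} (E : Set (Equation A V)) : Prop :=
  ∀ t s : Term A V, (t, s) ∈ E → SoundEquation t s

/-- Every equation between (possibly open) terms that is sound modulo rooted weak bisimilarity
is derivable from `E`. -/
def Complete {A : Type u} {V : Type v} (E : Set (Equation A V)) : Prop :=
  ∀ t s : Term A V, SoundEquation t s → Derivable E t s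

end CCS

namespace CCS

universe u v w

variable {A : Type u} {V : Type v}

/-! ### Weak bisimilarity is an equivalence and a congruence for parallel composition -/

/-! Let `fan a n` be the sum of the a.(a + a^(i+2)) for i < n, and `target a n` = a ∥ `fan a n`.
Expanding the parallel composition gives the closed sound equation `target a n` ≈ `expansion a n`,
whose right-hand side is a sum of prefixes. It is not derivable from sound axioms whose terms all
have size below n.

The invariant of derivations is `HasTarget`: up to inert components, some summand is a genuine
parallel composition weakly bisimilar to `target a n`. It is compared only on processes satisfying
`Below`. These have no initial silent step and never communicate, which tames the weak semantics.

The hard case is an instance of an axiom t ≈ u (`SoundEquation.hasTarget`). By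
`decomposition_target`, the parallel subterm of t responsible for the target splits into a component
like a and one like the fan. The latter has n inequivalent derivatives but fewer than n symbols, so
two of these come from one unguarded variable x (`exists_unguarded_var`), next to a context of
length 1. By `SoundEquation.exists_unguarded`, u also has x unguarded next to a context of length 1.
There the two stems force the neighbourhood of x to be the target again
(`weakBisimilar_target_of_step`). -/

theorem Silent.parLeft {p p' : Proc A} (q : Proc A) (h : Silent p p') :
    Silent (.par p q) (.par p' q) := by
  induction h with
  | refl => exact .refl
  | tail _ h ih => exact ih.tail (.parLeft q h)

theorem Silent.parRight {q q' : Proc A} (p : Proc A) (h : Silent q q') :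
    Silent (.par p q) (.par p q') := by
  induction h with
  | refl => exact .refl
  | tail _ h ih => exact ih.tail (.parRight p h)

theorem Step.strictWeakStep {p q : Proc A} {μ : Act A} (h : Step p μ q) : StrictWeakStep p μ q :=
  ⟨p, q, .refl, h, .refl⟩

theorem StrictWeakStep.silent {p q : Proc A} (h : StrictWeakStep p .tau q) : Silent p q := by
  obtain ⟨r, s, h₁, h₂, h₃⟩ := h
  exact h₁.trans (.head h₂ h₃)

theorem StrictWeakStep.parLeft {p p' : Proc A} {μ : Act A} (q : Proc A)
    (h : StrictWeakStep p μ p') : StrictWeakStep (.par p q) μ (.par p' q) := by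
  obtain ⟨r, s, h₁, h₂, h₃⟩ := h
  exact ⟨_, _, h₁.parLeft q, h₂.parLeft q, h₃.parLeft q⟩

theorem StrictWeakStep.parRight {q q' : Proc A} {μ : Act A} (p : Proc A)
    (h : StrictWeakStep q μ q') : StrictWeakStep (.par p q) μ (.par p q') := by
  obtain ⟨r, s, h₁, h₂, h₃⟩ := h
  exact ⟨_, _, h₁.parRight p, h₂.parRight p, h₃.parRight p⟩

theorem StrictWeakStep.comm {p p' q q' : Proc A} {α : Label A}
    (hp : StrictWeakStep p (.vis α) p') (hq : StrictWeakStep q (.vis α.bar) q') :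
    StrictWeakStep (.par p q) .tau (.par p' q') := by
  obtain ⟨r, s, h₁, h₂, h₃⟩ := hp
  obtain ⟨r', s', h₁', h₂', h₃'⟩ := hq
  exact ⟨_, _, (h₁.parLeft q).trans (h₁'.parRight _), .comm h₂ h₂',
    (h₃.parLeft _).trans (h₃'.parRight _)⟩

/-- The first actual step, silent or not, resolves the choice. Idling would not, which is why sums
require the rooted relation. -/
theorem StrictWeakStep.addLeft {p p' : Proc A} {μ : Act A} (q : Proc A)
    (h : StrictWeakStep p μ p') : StrictWeakStep (.add p q) μ p' := by
  obtain ⟨r, s, h₁, h₂, h₃⟩ := h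
  rcases Relation.ReflTransGen.cases_head h₁ with rfl | ⟨c, hc, hc'⟩
  · exact ⟨_, _, .refl, .addLeft q h₂, h₃⟩
  · exact ⟨_, _, .head (.addLeft q hc) hc', h₂, h₃⟩

theorem StrictWeakStep.addRight {q q' : Proc A} {μ : Act A} (p : Proc A)
    (h : StrictWeakStep q μ q') : StrictWeakStep (.add p q) μ q' := by
  obtain ⟨r, s, h₁, h₂, h₃⟩ := h
  rcases Relation.ReflTransGen.cases_head h₁ with rfl | ⟨c, hc, hc'⟩
  · exact ⟨_, _, .refl, .addRight p h₂, h₃⟩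
  · exact ⟨_, _, .head (.addRight p hc) hc', h₂, h₃⟩

theorem Label.bar_bar (l : Label A) : l.bar.bar = l := by cases l <;> rfl

theorem WeakBisimilar.refl (p : Proc A) : WeakBisimilar p p :=
  ⟨Eq, ⟨fun _ _ h => h.symm, fun _ _ p' h hs => .inr ⟨p', h ▸ .single hs, rfl⟩,
    fun _ _ _ p' h hs => ⟨p', h ▸ hs.strictWeakStep, rfl⟩⟩, rfl⟩

theorem WeakBisimilar.symm {p q : Proc A} (h : WeakBisimilar p q) : WeakBisimilar q p := by
  obtain ⟨R, hR, h⟩ := h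
  exact ⟨R, hR, hR.symm _ _ h⟩

theorem WeakBisimilar.tau {p q p' : Proc A} (h : WeakBisimilar p q) (hs : Step p .tau p') :
    ∃ q', Silent q q' ∧ WeakBisimilar p' q' := by
  obtain ⟨R, hR, h⟩ := h
  rcases hR.tau _ _ _ h hs with h' | ⟨q', h₁, h₂⟩
  · exact ⟨q, .refl, R, hR, h'⟩
  · exact ⟨q', h₁, R, hR, h₂⟩

theorem WeakBisimilar.vis {p q p' : Proc A} {α : Label A} (h : WeakBisimilar p q)
    (hs : Step p (.vis α) p') : ∃ q', StrictWeakStep q (.vis α) q' ∧ WeakBisimilar p' q' := by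
  obtain ⟨R, hR, h⟩ := h
  obtain ⟨q', h₁, h₂⟩ := hR.vis _ _ _ _ h hs
  exact ⟨q', h₁, R, hR, h₂⟩

theorem WeakBisimilar.silent {p q p' : Proc A} (h : WeakBisimilar p q) (hs : Silent p p') :
    ∃ q', Silent q q' ∧ WeakBisimilar p' q' := by
  induction hs with
  | refl => exact ⟨q, .refl, h⟩
  | tail _ hs ih =>
    obtain ⟨q₁, h₁, h₂⟩ := ih
    obtain ⟨q₂, h₃, h₄⟩ := h₂.tau hs
    exact ⟨q₂, h₁.trans h₃, h₄⟩

theorem WeakBisimilar.strict {p q p' : Proc A} {α : Label A} (h : WeakBisimilar p q)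
    (hs : StrictWeakStep p (.vis α) p') :
    ∃ q', StrictWeakStep q (.vis α) q' ∧ WeakBisimilar p' q' := by
  obtain ⟨r, s, h₁, h₂, h₃⟩ := hs
  obtain ⟨q₁, k₁, e₁⟩ := h.silent h₁
  obtain ⟨q₂, ⟨x, y, k₂, k₃, k₄⟩, e₂⟩ := e₁.vis h₂
  obtain ⟨q₃, k₅, e₃⟩ := e₂.silent h₃
  exact ⟨q₃, ⟨x, y, k₁.trans k₂, k₃, k₄.trans k₅⟩, e₃⟩

/-- A symmetric relation with the weak transfer properties is contained in weak bisimilarity. -/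
theorem WeakBisimilar.of_rel (R : Proc A → Proc A → Prop) (hsymm : ∀ p q, R p q → R q p)
    (htau : ∀ p q p', R p q → Step p .tau p' → ∃ q', Silent q q' ∧ R p' q')
    (hvis : ∀ p q α p', R p q → Step p (.vis α) p' →
      ∃ q', StrictWeakStep q (.vis α) q' ∧ R p' q') {p q : Proc A} (h : R p q) :
    WeakBisimilar p q :=
  ⟨R, ⟨hsymm, fun _ _ _ h hs => .inr (htau _ _ _ h hs), hvis⟩, h⟩

/-- A relation that is a strong bisimulation is contained in weak bisimilarity. -/
theorem WeakBisimilar.of_strong (R : Proc A → Proc A → Prop)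
    (h₁ : ∀ p q μ p', R p q → Step p μ p' → ∃ q', Step q μ q' ∧ R p' q')
    (h₂ : ∀ p q μ q', R p q → Step q μ q' → ∃ p', Step p μ p' ∧ R p' q')
    {p q : Proc A} (h : R p q) : WeakBisimilar p q := by
  have key : ∀ p q μ p', (R p q ∨ R q p) → Step p μ p' →
      ∃ q', Step q μ q' ∧ (R p' q' ∨ R q' p') := by
    rintro p q μ p' (h | h) hs
    · obtain ⟨q', a, b⟩ := h₁ _ _ _ _ h hs
      exact ⟨q', a, .inl b⟩
    · obtain ⟨q', a, b⟩ := h₂ _ _ _ _ h hs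
      exact ⟨q', a, .inr b⟩
  refine WeakBisimilar.of_rel (fun p q => R p q ∨ R q p) (fun _ _ h => h.symm) ?_ ?_ (.inl h)
  · intro p q p' h hs
    obtain ⟨q', a, b⟩ := key _ _ _ _ h hs
    exact ⟨q', .single a, b⟩
  · intro p q α p' h hs
    obtain ⟨q', a, b⟩ := key _ _ _ _ h hs
    exact ⟨q', a.strictWeakStep, b⟩

theorem WeakBisimilar.trans {p q r : Proc A} (h : WeakBisimilar p q) (h' : WeakBisimilar q r) :
    WeakBisimilar p r := by
  refine WeakBisimilar.of_rel (fun p r => ∃ q, WeakBisimilar p q ∧ WeakBisimilar q r)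
    (fun _ _ ⟨q, a, b⟩ => ⟨q, b.symm, a.symm⟩) ?_ ?_ ⟨q, h, h'⟩
  · rintro p r p' ⟨q, a, b⟩ hs
    obtain ⟨q', h₁, h₂⟩ := a.tau hs
    obtain ⟨r', h₃, h₄⟩ := b.silent h₁
    exact ⟨r', h₃, q', h₂, h₄⟩
  · rintro p r α p' ⟨q, a, b⟩ hs
    obtain ⟨q', h₁, h₂⟩ := a.vis hs
    obtain ⟨r', h₃, h₄⟩ := b.strict h₁
    exact ⟨r', h₃, q', h₂, h₄⟩

theorem Step.par_swap {p q r : Proc A} {μ : Act A} (h : Step (.par p q) μ r) :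
    ∃ p' q', r = .par p' q' ∧ Step (.par q p) μ (.par q' p') := by
  cases h with
  | parLeft q h => exact ⟨_, _, rfl, .parRight _ h⟩
  | parRight p h => exact ⟨_, _, rfl, .parLeft _ h⟩
  | comm hp hq => exact ⟨_, _, rfl, .comm hq (by rwa [Label.bar_bar])⟩

theorem WeakBisimilar.par_comm (p q : Proc A) : WeakBisimilar (.par p q) (.par q p) := by
  refine WeakBisimilar.of_strong (fun x y => ∃ p q, x = .par p q ∧ y = .par q p) ?_ ?_
    ⟨p, q, rfl, rfl⟩
  · rintro _ _ μ r ⟨p, q, rfl, rfl⟩ hs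
    obtain ⟨p', q', rfl, h⟩ := hs.par_swap
    exact ⟨_, h, _, _, rfl, rfl⟩
  · rintro _ _ μ r ⟨p, q, rfl, rfl⟩ hs
    obtain ⟨p', q', rfl, h⟩ := hs.par_swap
    exact ⟨_, h, _, _, rfl, rfl⟩

theorem WeakBisimilar.par_assoc (p q r : Proc A) :
    WeakBisimilar (.par (.par p q) r) (.par p (.par q r)) := by
  refine WeakBisimilar.of_strong
    (fun x y => ∃ p q r, x = .par (.par p q) r ∧ y = .par p (.par q r)) ?_ ?_ ⟨p, q, r, rfl, rfl⟩
  · rintro _ _ μ s ⟨p, q, r, rfl, rfl⟩ hs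
    cases hs with
    | parLeft _ h =>
      cases h with
      | parLeft _ h => exact ⟨_, .parLeft _ h, _, _, _, rfl, rfl⟩
      | parRight _ h => exact ⟨_, .parRight _ (.parLeft _ h), _, _, _, rfl, rfl⟩
      | comm h h' => exact ⟨_, .comm h (.parLeft _ h'), _, _, _, rfl, rfl⟩
    | parRight _ h => exact ⟨_, .parRight _ (.parRight _ h), _, _, _, rfl, rfl⟩
    | comm h h' =>
      cases h with
      | parLeft _ h => exact ⟨_, .comm h (.parRight _ h'), _, _, _, rfl, rfl⟩
      | parRight _ h => exact ⟨_, .parRight _ (.comm h h'), _, _, _, rfl, rfl⟩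
  · rintro _ _ μ s ⟨p, q, r, rfl, rfl⟩ hs
    cases hs with
    | parRight _ h =>
      cases h with
      | parLeft _ h => exact ⟨_, .parLeft _ (.parRight _ h), _, _, _, rfl, rfl⟩
      | parRight _ h => exact ⟨_, .parRight _ h, _, _, _, rfl, rfl⟩
      | comm h h' => exact ⟨_, .comm (.parRight _ h) h', _, _, _, rfl, rfl⟩
    | parLeft _ h => exact ⟨_, .parLeft _ (.parLeft _ h), _, _, _, rfl, rfl⟩
    | comm h h' =>
      cases h' with
      | parLeft _ h' => exact ⟨_, .parLeft _ (.comm h h'), _, _, _, rfl, rfl⟩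
      | parRight _ h' => exact ⟨_, .comm (.parLeft _ h) h', _, _, _, rfl, rfl⟩

theorem WeakBisimilar.par_left {p q : Proc A} (r : Proc A) (h : WeakBisimilar p q) :
    WeakBisimilar (.par p r) (.par q r) := by
  refine WeakBisimilar.of_rel
    (fun x y => ∃ p q r, WeakBisimilar p q ∧ x = .par p r ∧ y = .par q r) ?_ ?_ ?_
    ⟨p, q, r, h, rfl, rfl⟩
  · rintro _ _ ⟨p, q, r, h, rfl, rfl⟩
    exact ⟨q, p, r, h.symm, rfl, rfl⟩
  · rintro _ _ s ⟨p, q, r, h, rfl, rfl⟩ hs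
    cases hs with
    | parLeft _ hs =>
      obtain ⟨q', h₁, h₂⟩ := h.tau hs
      exact ⟨_, h₁.parLeft r, _, _, _, h₂, rfl, rfl⟩
    | parRight _ hs => exact ⟨_, .single (.parRight _ hs), _, _, _, h, rfl, rfl⟩
    | comm hs hs' =>
      obtain ⟨q', h₁, h₂⟩ := h.vis hs
      exact ⟨_, (h₁.comm hs'.strictWeakStep).silent, _, _, _, h₂, rfl, rfl⟩
  · rintro _ _ α s ⟨p, q, r, h, rfl, rfl⟩ hs
    cases hs with
    | parLeft _ hs =>
      obtain ⟨q', h₁, h₂⟩ := h.vis hs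
      exact ⟨_, h₁.parLeft r, _, _, _, h₂, rfl, rfl⟩
    | parRight _ hs => exact ⟨_, (Step.parRight _ hs).strictWeakStep, _, _, _, h, rfl, rfl⟩

theorem WeakBisimilar.par {p q p' q' : Proc A} (h : WeakBisimilar p q)
    (h' : WeakBisimilar p' q') : WeakBisimilar (.par p p') (.par q q') :=
  (h.par_left p').trans ((par_comm _ _).trans ((h'.par_left q).trans (par_comm _ _)))

/-! ### Rooted weak bisimilarity is a congruence -/

theorem RootedWeakBisimilar.refl (p : Proc A) : RootedWeakBisimilar p p :=
  ⟨fun _ p' h => ⟨p', h.strictWeakStep, .refl _⟩, fun _ p' h => ⟨p', h.strictWeakStep, .refl _⟩⟩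

theorem RootedWeakBisimilar.symm {p q : Proc A} (h : RootedWeakBisimilar p q) :
    RootedWeakBisimilar q p :=
  ⟨h.2, h.1⟩

theorem RootedWeakBisimilar.weakBisimilar {p q : Proc A} (h : RootedWeakBisimilar p q) :
    WeakBisimilar p q := by
  refine WeakBisimilar.of_rel (fun p q => WeakBisimilar p q ∨ RootedWeakBisimilar p q)
    (fun _ _ h => h.imp .symm .symm) ?_ ?_ (.inr h)
  · rintro p q p' (h | h) hs
    · obtain ⟨q', h₁, h₂⟩ := h.tau hs
      exact ⟨q', h₁, .inl h₂⟩
    · obtain ⟨q', h₁, h₂⟩ := h.1 _ _ hs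
      exact ⟨q', h₁.silent, .inl h₂⟩
  · rintro p q α p' (h | h) hs
    · obtain ⟨q', h₁, h₂⟩ := h.vis hs
      exact ⟨q', h₁, .inl h₂⟩
    · obtain ⟨q', h₁, h₂⟩ := h.1 _ _ hs
      exact ⟨q', h₁, .inl h₂⟩

/-- Only the first step needs the root condition. After it the processes are weakly bisimilar, and
the rest of the weak transition is matched as usual. -/
theorem RootedWeakBisimilar.strict {p q p' : Proc A} {μ : Act A} (h : RootedWeakBisimilar p q)
    (hs : StrictWeakStep p μ p') : ∃ q', StrictWeakStep q μ q' ∧ WeakBisimilar p' q' := by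
  obtain ⟨r, s, h₁, h₂, h₃⟩ := hs
  rcases Relation.ReflTransGen.cases_head h₁ with rfl | ⟨c, hc, hc'⟩
  · obtain ⟨q₁, ⟨x, y, k₁, k₂, k₃⟩, e₁⟩ := h.1 _ _ h₂
    obtain ⟨q₂, k₄, e₂⟩ := e₁.silent h₃
    exact ⟨q₂, ⟨x, y, k₁, k₂, k₃.trans k₄⟩, e₂⟩
  · obtain ⟨q₁, ⟨x, y, k₁, k₂, k₃⟩, e₁⟩ := h.1 _ _ hc
    cases μ with
    | vis α =>
      obtain ⟨q₂, ⟨x', y', k₄, k₅, k₆⟩, e₂⟩ := e₁.strict ⟨r, s, hc', h₂, h₃⟩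
      exact ⟨q₂, ⟨x', y', k₁.trans ((Relation.ReflTransGen.head k₂ k₃).trans k₄), k₅, k₆⟩, e₂⟩
    | tau =>
      obtain ⟨q₂, k₄, e₂⟩ := e₁.silent (hc'.trans (.head h₂ h₃))
      exact ⟨q₂, ⟨x, y, k₁, k₂, k₃.trans k₄⟩, e₂⟩

theorem RootedWeakBisimilar.trans {p q r : Proc A} (h : RootedWeakBisimilar p q)
    (h' : RootedWeakBisimilar q r) : RootedWeakBisimilar p r := by
  constructor
  · intro μ p' hs
    obtain ⟨q', h₁, h₂⟩ := h.1 _ _ hs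
    obtain ⟨r', h₃, h₄⟩ := h'.strict h₁
    exact ⟨r', h₃, h₂.trans h₄⟩
  · intro μ r' hs
    obtain ⟨q', h₁, h₂⟩ := h'.2 _ _ hs
    obtain ⟨p', h₃, h₄⟩ := h.symm.strict h₁
    exact ⟨p', h₃, h₂.trans h₄⟩

theorem RootedWeakBisimilar.of_half (R : Proc A → Proc A → Prop) (hR : ∀ p q, R p q → R q p)
    (h : ∀ p q μ p', R p q → Step p μ p' → ∃ q', StrictWeakStep q μ q' ∧ WeakBisimilar p' q')
    {p q : Proc A} (hpq : R p q) : RootedWeakBisimilar p q :=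
  ⟨fun _ _ hs => h _ _ _ _ hpq hs, fun _ _ hs => h _ _ _ _ (hR _ _ hpq) hs⟩

theorem RootedWeakBisimilar.pre {p q : Proc A} (μ : Act A) (h : RootedWeakBisimilar p q) :
    RootedWeakBisimilar (.pre μ p) (.pre μ q) := by
  constructor
  · intro _ _ hs
    cases hs
    exact ⟨q, (Step.pre μ q).strictWeakStep, h.weakBisimilar⟩
  · intro _ _ hs
    cases hs
    exact ⟨p, (Step.pre μ p).strictWeakStep, h.weakBisimilar.symm⟩

theorem RootedWeakBisimilar.add {p q p' q' : Proc A} (h : RootedWeakBisimilar p q)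
    (h' : RootedWeakBisimilar p' q') : RootedWeakBisimilar (.add p p') (.add q q') := by
  refine RootedWeakBisimilar.of_half (fun x y => ∃ p q p' q', RootedWeakBisimilar p q ∧
    RootedWeakBisimilar p' q' ∧ x = .add p p' ∧ y = .add q q') ?_ ?_ ⟨_, _, _, _, h, h', rfl, rfl⟩
  · rintro _ _ ⟨_, _, _, _, h, h', rfl, rfl⟩
    exact ⟨_, _, _, _, h.symm, h'.symm, rfl, rfl⟩
  · rintro _ _ μ s ⟨_, _, _, _, h, h', rfl, rfl⟩ hs
    cases hs with
    | addLeft _ hs =>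
      obtain ⟨q', h₁, h₂⟩ := h.1 _ _ hs
      exact ⟨q', h₁.addLeft _, h₂⟩
    | addRight _ hs =>
      obtain ⟨q', h₁, h₂⟩ := h'.1 _ _ hs
      exact ⟨q', h₁.addRight _, h₂⟩

theorem RootedWeakBisimilar.par {p q p' q' : Proc A} (h : RootedWeakBisimilar p q)
    (h' : RootedWeakBisimilar p' q') : RootedWeakBisimilar (.par p p') (.par q q') := by
  refine RootedWeakBisimilar.of_half (fun x y => ∃ p q p' q', RootedWeakBisimilar p q ∧
    RootedWeakBisimilar p' q' ∧ x = .par p p' ∧ y = .par q q') ?_ ?_ ⟨_, _, _, _, h, h', rfl, rfl⟩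
  · rintro _ _ ⟨_, _, _, _, h, h', rfl, rfl⟩
    exact ⟨_, _, _, _, h.symm, h'.symm, rfl, rfl⟩
  · rintro _ _ μ s ⟨_, _, _, _, h, h', rfl, rfl⟩ hs
    cases hs with
    | parLeft _ hs =>
      obtain ⟨q', h₁, h₂⟩ := h.1 _ _ hs
      exact ⟨_, h₁.parLeft _, h₂.par h'.weakBisimilar⟩
    | parRight _ hs =>
      obtain ⟨q', h₁, h₂⟩ := h'.1 _ _ hs
      exact ⟨_, h₁.parRight _, h.weakBisimilar.par h₂⟩
    | comm hs hs' =>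
      obtain ⟨q₁, h₁, h₂⟩ := h.1 _ _ hs
      obtain ⟨q₂, h₃, h₄⟩ := h'.1 _ _ hs'
      exact ⟨_, h₁.comm h₃, h₂.par h₄⟩

theorem Term.subst_subst {W : Type w} (σ : V → Term A V) (ρ : V → Term A W) (t : Term A V) :
    (t.subst σ).subst ρ = t.subst (fun x => (σ x).subst ρ) := by
  induction t <;> simp_all [Term.subst]

/-- Equational logic is sound for rooted weak bisimilarity. -/
theorem Derivable.soundEquation {E : Set (Equation A V)} (hE : Sound E) {t s : Term A V}
    (h : Derivable E t s) : SoundEquation t s := by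
  induction h with
  | ax h => exact hE _ _ h
  | refl t => exact fun σ => .refl _
  | symm _ ih => exact fun σ => (ih σ).symm
  | trans _ _ ih₁ ih₂ => exact fun σ => (ih₁ σ).trans (ih₂ σ)
  | subst ρ _ ih => exact fun σ => by simpa only [Term.subst_subst] using ih _
  | pre μ _ ih => exact fun σ => (ih σ).pre μ
  | add _ _ ih₁ ih₂ => exact fun σ => (ih₁ σ).add (ih₂ σ)
  | par _ _ ih₁ ih₂ => exact fun σ => (ih₁ σ).par (ih₂ σ)

/-! ### Size and weighted depth -/

/-- The number of symbols of a term. -/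
def Term.size : Term A V → ℕ
  | .nil => 1
  | .var _ => 1
  | .pre _ t => t.size + 1
  | .add t s => t.size + s.size + 1
  | .par t s => t.size + s.size + 1

/-- The weight of an action, where silent actions are weightless. -/
def Act.weight (w : Label A → ℕ) : Act A → ℕ
  | .vis l => w l
  | .tau => 0

/-- The maximal total weight of a trace. -/
def Term.depth (w : Label A → ℕ) : Term A V → ℕ
  | .nil => 0
  | .var _ => 0
  | .pre μ t => μ.weight w + t.depth w
  | .add t s => max (t.depth w) (s.depth w)
  | .par t s => t.depth w + s.depth w

theorem Step.depth_le (w : Label A → ℕ) {p p' : Proc A} {μ : Act A} (h : Step p μ p') :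
    μ.weight w + p'.depth w ≤ p.depth w := by
  induction h <;> simp only [Term.depth, Act.weight] at * <;> omega

theorem Silent.depth_le (w : Label A → ℕ) {p p' : Proc A} (h : Silent p p') :
    p'.depth w ≤ p.depth w := by
  induction h with
  | refl => exact le_rfl
  | tail _ h ih => exact le_trans (by simpa [Act.weight] using h.depth_le w) ih

theorem StrictWeakStep.depth_le (w : Label A → ℕ) {p p' : Proc A} {μ : Act A}
    (h : StrictWeakStep p μ p') : μ.weight w + p'.depth w ≤ p.depth w := by
  obtain ⟨r, s, h₁, h₂, h₃⟩ := h
  have := h₁.depth_le w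
  have := h₂.depth_le w
  have := h₃.depth_le w
  omega

/-- Interleaving realises the maximal weight, so communication is not needed. The step may be
weightless, hence the decrease in size for later inductions. -/
theorem exists_step_depth_eq (w : Label A → ℕ) (p : Proc A) (h : p.depth w ≠ 0) :
    ∃ μ p', Step p μ p' ∧ μ.weight w + p'.depth w = p.depth w ∧ p'.size < p.size := by
  induction p with
  | nil => simp [Term.depth] at h
  | var x => exact x.elim
  | pre μ p => exact ⟨μ, p, .pre μ p, rfl, by simp [Term.size]⟩
  | add p q ihp ihq =>
    simp only [Term.depth, Term.size] at *
    rcases le_total (q.depth w) (p.depth w) with hle | hle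
    · obtain ⟨μ, p', h₁, h₂, h₃⟩ := ihp (by omega)
      exact ⟨μ, p', .addLeft _ h₁, by omega, by omega⟩
    · obtain ⟨μ, p', h₁, h₂, h₃⟩ := ihq (by omega)
      exact ⟨μ, p', .addRight _ h₁, by omega, by omega⟩
  | par p q ihp ihq =>
    by_cases hp : p.depth w = 0
    · simp only [Term.depth] at h
      obtain ⟨μ, p', h₁, h₂, h₃⟩ := ihq (by omega)
      exact ⟨μ, _, .parRight _ h₁, by simp only [Term.depth]; omega,
        by simp only [Term.size]; omega⟩
    · obtain ⟨μ, p', h₁, h₂, h₃⟩ := ihp hp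
      exact ⟨μ, _, .parLeft _ h₁, by simp only [Term.depth]; omega,
        by simp only [Term.size]; omega⟩

/-- Follow a heaviest trace of p step by step; q answers with the same weight, as silent steps weigh
nothing. The invariant is used for two weights: constant 1 (length) and `foreignWeight` (alphabet).
-/
theorem WeakBisimilar.depth_le (w : Label A → ℕ) : ∀ (n : ℕ) {p q : Proc A}, p.size ≤ n →
    WeakBisimilar p q → p.depth w ≤ q.depth w := by
  intro n
  induction n with
  | zero => intro p q hn; cases p <;> simp [Term.size] at hn
  | succ n ih =>
    intro p q hn h
    by_cases h0 : p.depth w = 0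
    · omega
    obtain ⟨μ, p', h₁, h₂, h₃⟩ := exists_step_depth_eq w p h0
    cases μ with
    | tau =>
      obtain ⟨q', k₁, k₂⟩ := h.tau h₁
      have := ih (by omega) k₂
      have := k₁.depth_le w
      simp only [Act.weight] at h₂
      omega
    | vis α =>
      obtain ⟨q', k₁, k₂⟩ := h.vis h₁
      have := ih (by omega) k₂
      have := k₁.depth_le w
      omega

theorem WeakBisimilar.depth_eq (w : Label A → ℕ) {p q : Proc A} (h : WeakBisimilar p q) :
    p.depth w = q.depth w :=
  le_antisymm (h.depth_le w _ le_rfl) (h.symm.depth_le w _ le_rfl)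

/-- The maximal number of visible actions in a trace. -/
abbrev Term.len (t : Term A V) : ℕ := t.depth fun _ => 1

theorem Step.len_lt {p p' : Proc A} {α : Label A} (h : Step p (.vis α) p') : p'.len < p.len := by
  have := h.depth_le fun _ => 1
  simp only [Act.weight] at this
  simp only [Term.len]
  omega

/-- A parallel component without visible behaviour can be dropped. -/
theorem WeakBisimilar.par_of_len_eq_zero (q : Proc A) {p : Proc A} (h : p.len = 0) :
    WeakBisimilar (.par q p) q := by
  refine WeakBisimilar.of_rel (fun x y => ∃ q p, Term.len p = 0 ∧
    ((x = .par q p ∧ y = q) ∨ (y = .par q p ∧ x = q))) ?_ ?_ ?_ ⟨q, p, h, .inl ⟨rfl, rfl⟩⟩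
  · rintro _ _ ⟨q, p, h, h'⟩
    exact ⟨q, p, h, h'.symm⟩
  · rintro _ _ s ⟨q, p, h, ⟨rfl, rfl⟩ | ⟨rfl, rfl⟩⟩ hs
    · cases hs with
      | parLeft _ hs => exact ⟨_, .single hs, _, _, h, .inl ⟨rfl, rfl⟩⟩
      | parRight _ hs =>
        have := hs.depth_le fun _ => 1
        exact ⟨_, .refl, _, _, by simp only [Act.weight, Term.len] at *; omega, .inl ⟨rfl, rfl⟩⟩
      | comm _ hs => exact absurd hs.len_lt (by omega)
    · exact ⟨_, .single (.parLeft _ hs), _, _, h, .inr ⟨rfl, rfl⟩⟩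
  · rintro _ _ α s ⟨q, p, h, ⟨rfl, rfl⟩ | ⟨rfl, rfl⟩⟩ hs
    · cases hs with
      | parLeft _ hs => exact ⟨_, hs.strictWeakStep, _, _, h, .inl ⟨rfl, rfl⟩⟩
      | parRight _ hs => exact absurd hs.len_lt (by omega)
    · exact ⟨_, (Step.parLeft _ hs).strictWeakStep, _, _, h, .inr ⟨rfl, rfl⟩⟩

theorem WeakBisimilar.of_len_eq_zero {p q : Proc A} (hp : p.len = 0) (hq : q.len = 0) :
    WeakBisimilar p q :=
  (par_of_len_eq_zero p hq).symm.trans ((par_comm _ _).trans (par_of_len_eq_zero q hp))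

/-! ### Processes over a single action name -/

/-- The action `a`. -/
abbrev act (a : A) : Act A := .vis (.name a)

/-- The weight that counts the visible actions other than `a`. -/
noncomputable def foreignWeight (a : A) : Label A → ℕ :=
  open Classical in fun l => if l = .name a then 0 else 1

/-- All actions that the process may perform, now or later, are `a` or silent. -/
def Uses (a : A) (p : Proc A) : Prop := p.depth (foreignWeight a) = 0

theorem Uses.step {a : A} {p p' : Proc A} {μ : Act A} (h : Uses a p) (hs : Step p μ p') :
    (μ = .tau ∨ μ = act a) ∧ Uses a p' := by
  have h₁ := hs.depth_le (foreignWeight a)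
  unfold Uses at h
  refine ⟨?_, by unfold Uses; omega⟩
  cases μ with
  | tau => exact .inl rfl
  | vis l =>
    by_cases hl : l = .name a
    · exact .inr (by rw [hl])
    · simp only [Act.weight, foreignWeight, if_neg hl] at h₁
      omega

/-- One of the partners would have to perform a co-name, which `foreignWeight` counts. -/
theorem Uses.not_comm {a : A} {p q p' q' : Proc A} {α : Label A} (h : Uses a (.par p q))
    (hp : Step p (.vis α) p') (hq : Step q (.vis α.bar) q') : False := by
  have h₁ := (h.step (.parLeft q hp)).1
  have h₂ := (h.step (.parRight p hq)).1
  simp only [Act.vis.injEq, reduceCtorEq, false_or] at h₁ h₂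
  subst h₁
  cases h₂

theorem WeakBisimilar.uses {a : A} {p q : Proc A} (h : WeakBisimilar p q) (hp : Uses a p) :
    Uses a q := by
  unfold Uses at *
  rw [← h.depth_eq]
  exact hp

/-- The only prefixes of the process are `a`. -/
def Pure (a : A) : Proc A → Prop
  | .nil => True
  | .var _ => True
  | .pre μ p => μ = act a ∧ Pure a p
  | .add p q => Pure a p ∧ Pure a q
  | .par p q => Pure a p ∧ Pure a q

theorem Pure.uses {a : A} {p : Proc A} (h : Pure a p) : Uses a p := by
  unfold Uses
  induction p with
  | nil => rfl
  | var x => rfl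
  | pre μ p ih => simp [Term.depth, h.1, Act.weight, foreignWeight, ih h.2]
  | add p q ihp ihq => simp [Term.depth, ihp h.1, ihq h.2]
  | par p q ihp ihq => simp [Term.depth, ihp h.1, ihq h.2]

theorem Pure.step {a : A} {p p' : Proc A} {μ : Act A} (h : Pure a p) (hs : Step p μ p') :
    μ = act a ∧ Pure a p' := by
  induction hs with
  | pre μ p => exact h
  | addLeft q _ ih => exact ih h.1
  | addRight q _ ih => exact ih h.2
  | parLeft q _ ih => exact ⟨(ih h.1).1, (ih h.1).2, h.2⟩
  | parRight q _ ih => exact ⟨(ih h.2).1, h.1, (ih h.2).2⟩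
  | comm hp hq => exact (h.uses.not_comm hp hq).elim

theorem Pure.not_tau {a : A} {p p' : Proc A} (h : Pure a p) : ¬ Step p .tau p' := by
  intro hs
  cases (h.step hs).1

/-- A process without silent steps can only idle. -/
theorem Silent.eq_of_stable {p q : Proc A} (h : ∀ r, ¬ Step p .tau r) (hs : Silent p q) :
    q = p := by
  rcases Relation.ReflTransGen.cases_head hs with rfl | ⟨c, hc, -⟩
  · rfl
  · exact (h _ hc).elim

theorem Pure.silent_eq {a : A} {p q : Proc A} (h : Pure a p) (hs : Silent p q) : q = p :=
  hs.eq_of_stable fun _ => h.not_tau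

theorem Pure.strict {a : A} {p q : Proc A} {μ : Act A} (h : Pure a p)
    (hs : StrictWeakStep p μ q) : Step p μ q := by
  obtain ⟨r, s, h₁, h₂, h₃⟩ := hs
  obtain rfl := h.silent_eq h₁
  obtain rfl := (h.step h₂).2.silent_eq h₃
  exact h₂

/-- A pure process has no silent step, so it can only answer silent moves by idling. -/
theorem WeakBisimilar.of_silent {a : A} {p p' x : Proc A} (h : WeakBisimilar p x)
    (hx : Pure a x) (hs : Silent p p') : WeakBisimilar p' x := by
  obtain ⟨x', h₁, h₂⟩ := h.silent hs
  rwa [hx.silent_eq h₁] at h₂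

theorem WeakBisimilar.of_vis {a : A} {p p' x : Proc A} {α : Label A} (h : WeakBisimilar p x)
    (hx : Pure a x) (hs : Step p (.vis α) p') :
    ∃ x', Step x (.vis α) x' ∧ WeakBisimilar p' x' := by
  obtain ⟨x', h₁, h₂⟩ := h.vis hs
  exact ⟨x', hx.strict h₁, h₂⟩

/-- The visible step that matches a step of a pure process leads to the right process at once. -/
theorem WeakBisimilar.match_pure {a : A} {p x x' : Proc A} {μ : Act A} (h : WeakBisimilar p x)
    (hx : Pure a x) (hs : Step x μ x') :
    ∃ p₁ p₂, Silent p p₁ ∧ WeakBisimilar p₁ x ∧ Step p₁ μ p₂ ∧ WeakBisimilar p₂ x' := by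
  obtain ⟨rfl, hx'⟩ := hx.step hs
  obtain ⟨q, ⟨p₁, p₂, h₁, h₂, h₃⟩, e⟩ := h.symm.vis hs
  -- Silent steps do not change the class: those before the visible step stay at `x`, and those
  -- after it make `p₂` and `q` equivalent.
  have e₁ := h.of_silent hx h₁
  obtain ⟨x₂, k₁, k₂⟩ := e₁.of_vis hx h₂
  have k₃ := k₂.of_silent (hx.step k₁).2 h₃
  exact ⟨p₁, p₂, h₁, e₁, h₂, k₂.trans (k₃.symm.trans e.symm)⟩

theorem WeakBisimilar.match_pure_of_stable {a : A} {p x x' : Proc A} {μ : Act A}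
    (h : WeakBisimilar p x) (hx : Pure a x) (hs : Step x μ x') (hp : ∀ r, ¬ Step p .tau r) :
    ∃ p', Step p μ p' ∧ WeakBisimilar p' x' := by
  obtain ⟨p₁, p₂, h₁, -, h₂, h₃⟩ := h.match_pure hx hs
  obtain rfl := h₁.eq_of_stable hp
  exact ⟨p₂, h₂, h₃⟩

/-! ### Parallel decompositions and parallel primes -/

theorem Silent.par_inv {p q r : Proc A} (h : Silent (.par p q) r) :
    ∃ p₁ q₁, r = .par p₁ q₁ ∧ p₁.len ≤ p.len ∧ q₁.len ≤ q.len := by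
  induction h with
  | refl => exact ⟨p, q, rfl, le_rfl, le_rfl⟩
  | tail _ hs ih =>
    obtain ⟨p₁, q₁, rfl, h₁, h₂⟩ := ih
    cases hs with
    | parLeft _ hs =>
      exact ⟨_, _, rfl, (by simpa [Act.weight] using hs.depth_le _ : _ ≤ _).trans h₁, h₂⟩
    | parRight _ hs =>
      exact ⟨_, _, rfl, h₁, (by simpa [Act.weight] using hs.depth_le _ : _ ≤ _).trans h₂⟩
    | comm hs hs' => exact ⟨_, _, rfl, hs.len_lt.le.trans h₁, hs'.len_lt.le.trans h₂⟩

theorem WeakBisimilar.par_match {a : A} {p q x x' : Proc A} (h : WeakBisimilar (.par p q) x)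
    (hx : Pure a x) (hs : Step x (act a) x') :
    ∃ p₁ q₁, WeakBisimilar (.par p₁ q₁) x ∧ p₁.len = p.len ∧ q₁.len = q.len ∧
      ((∃ p₂, Step p₁ (act a) p₂ ∧ WeakBisimilar (.par p₂ q₁) x') ∨
        (∃ q₂, Step q₁ (act a) q₂ ∧ WeakBisimilar (.par p₁ q₂) x')) := by
  obtain ⟨r, r₂, h₁, h₂, h₃, h₄⟩ := h.match_pure hx hs
  obtain ⟨p₁, q₁, rfl, k₁, k₂⟩ := h₁.par_inv
  -- Neither length can grow and their sum is fixed, so both are unchanged.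
  have e : p.len + q.len = p₁.len + q₁.len := h.depth_eq _ |>.trans (h₂.depth_eq _).symm
  refine ⟨p₁, q₁, h₂, by omega, by omega, ?_⟩
  cases h₃ with
  | parLeft _ h => exact .inl ⟨_, h, h₄⟩
  | parRight _ h => exact .inr ⟨_, h, h₄⟩

/-- In each parallel decomposition of the process, one component has no visible behaviour. -/
def ParPrime (x : Proc A) : Prop :=
  ∀ p q, WeakBisimilar (.par p q) x → p.len = 0 ∨ q.len = 0

/-- The process performing `a` exactly `k` times. -/
def power (a : A) : ℕ → Proc A
  | 0 => .nil
  | k + 1 => .pre (act a) (power a k)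

theorem pure_power (a : A) (k : ℕ) : Pure a (power a k) := by
  induction k with
  | zero => trivial
  | succ k ih => exact ⟨rfl, ih⟩

theorem len_power (a : A) (k : ℕ) : (power a k).len = k := by
  induction k with
  | zero => rfl
  | succ k ih =>
    simp only [power, Term.len, Term.depth, Act.weight] at *
    omega

/-- The process `a + a^(i+2)`. -/
def stem (a : A) (i : ℕ) : Proc A := .add (power a 1) (power a (i + 2))

theorem pure_stem (a : A) (i : ℕ) : Pure a (stem a i) := ⟨pure_power a _, pure_power a _⟩

theorem len_stem (a : A) (i : ℕ) : (stem a i).len = i + 2 := by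
  have h₁ := len_power a 1
  have h₂ := len_power a (i + 2)
  simp only [stem, Term.len, Term.depth] at *
  omega

theorem step_stem_iff {a : A} {i : ℕ} {μ : Act A} {p : Proc A} :
    Step (stem a i) μ p ↔ μ = act a ∧ (p = .nil ∨ p = power a (i + 1)) := by
  constructor
  · rintro (_ | ⟨_, _ | _⟩ | ⟨_, _ | _⟩)
    · exact ⟨rfl, .inl rfl⟩
    · exact ⟨rfl, .inr rfl⟩
  · rintro ⟨rfl, rfl | rfl⟩
    · exact .addLeft _ (.pre _ _)
    · exact .addRight _ (.pre _ _)

/-- One step leads from the stem to `.nil`. The component that does not move in the match must have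
length zero. -/
theorem parPrime_stem (a : A) (i : ℕ) : ParPrime (stem a i) := by
  intro p q h
  obtain ⟨p₁, q₁, -, h₂, h₃, h₄⟩ :=
    h.par_match (pure_stem a i) (step_stem_iff.2 ⟨rfl, .inl rfl⟩)
  rcases h₄ with ⟨p₂, -, h₄⟩ | ⟨q₂, -, h₄⟩
  · have := h₄.depth_eq fun _ => 1
    simp only [Term.depth, Term.len] at *
    omega
  · have := h₄.depth_eq fun _ => 1
    simp only [Term.depth, Term.len] at *
    omega

/-- The sum of the processes `a.(a + a^(i+2))` for `i < n`. -/
def fan (a : A) : ℕ → Proc A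
  | 0 => .nil
  | n + 1 => .add (fan a n) (.pre (act a) (stem a n))

theorem pure_fan (a : A) (n : ℕ) : Pure a (fan a n) := by
  induction n with
  | zero => trivial
  | succ n ih => exact ⟨ih, rfl, pure_stem a n⟩

theorem step_fan_iff {a : A} {n : ℕ} {μ : Act A} {p : Proc A} :
    Step (fan a n) μ p ↔ μ = act a ∧ ∃ i < n, p = stem a i := by
  induction n with
  | zero =>
    constructor
    · rintro ⟨⟩
    · rintro ⟨-, i, hi, -⟩
      omega
  | succ n ih =>
    constructor
    · rintro (_ | ⟨_, h⟩ | ⟨_, _ | _⟩)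
      · obtain ⟨h₁, i, hi, h₂⟩ := ih.1 h
        exact ⟨h₁, i, by omega, h₂⟩
      · exact ⟨rfl, n, by omega, rfl⟩
    · rintro ⟨rfl, i, hi, rfl⟩
      rcases Nat.lt_succ_iff_lt_or_eq.1 hi with hi | rfl
      · exact .addLeft _ (ih.2 ⟨rfl, i, hi, rfl⟩)
      · exact .addRight _ (.pre _ _)

/-- If both components had positive length, a step to a stem would, by primality of stems, make the
idle component q a stem itself. Letting q take its long branch instead gives a process equivalent to
some stem in which both components still have positive length. -/
theorem parPrime_fan (a : A) (n : ℕ) : ParPrime (fan a n) := by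
  have key : ∀ p q p' i, p.len ≠ 0 → q.len ≠ 0 → WeakBisimilar (.par p q) (fan a n) →
      ¬ WeakBisimilar (.par p' q) (stem a i) := by
    intro p q p' i hp hq h h'
    have hp' : p'.len = 0 := (parPrime_stem a i _ _ h').resolve_right hq
    have hqi : WeakBisimilar q (stem a i) :=
      ((WeakBisimilar.par_comm _ _).trans (WeakBisimilar.par_of_len_eq_zero q hp')).symm.trans h'
    obtain ⟨q₁, q₂, h₁, -, h₂, h₃⟩ :=
      hqi.match_pure (pure_stem a i) (step_stem_iff.2 ⟨rfl, .inr rfl⟩)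
    have h₄ := h.of_silent (pure_fan a n) (h₁.parRight p)
    obtain ⟨x, h₅, h₆⟩ := h₄.of_vis (pure_fan a n) (.parRight p h₂)
    obtain ⟨-, j, -, rfl⟩ := step_fan_iff.1 h₅
    have h₇ : q₂.len = i + 1 := (h₃.depth_eq _).trans (len_power a (i + 1))
    rcases parPrime_stem a j _ _ h₆ with h₈ | h₈
    · exact hp h₈
    · omega
  intro p q h
  by_contra! hne
  have hn : n ≠ 0 := by
    rintro rfl
    have := h.depth_eq fun _ => 1
    simp only [Term.depth, Term.len, fan] at *
    omega
  obtain ⟨p₁, q₁, h₁, h₂, h₃, h₄⟩ :=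
    h.par_match (pure_fan a n) (step_fan_iff.2 ⟨rfl, 0, by omega, rfl⟩)
  rcases h₄ with ⟨p₂, -, h₄⟩ | ⟨q₂, -, h₄⟩
  · exact key _ _ _ _ (h₂ ▸ hne.1) (h₃ ▸ hne.2) h₁ h₄
  · exact key _ _ _ _ (h₃ ▸ hne.2) (h₂ ▸ hne.1) ((WeakBisimilar.par_comm _ _).trans h₁)
      ((WeakBisimilar.par_comm _ _).trans h₄)

/-! ### The processes `a ∥ fan a n` -/

/-- The process `a ∥ fan a n`. -/
def target (a : A) (n : ℕ) : Proc A := .par (power a 1) (fan a n)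

theorem pure_target (a : A) (n : ℕ) : Pure a (target a n) := ⟨pure_power a 1, pure_fan a n⟩

theorem step_power_one_iff {a : A} {μ : Act A} {p : Proc A} :
    Step (power a 1) μ p ↔ μ = act a ∧ p = .nil :=
  ⟨fun h => by cases h; exact ⟨rfl, rfl⟩, fun ⟨h₁, h₂⟩ => h₁ ▸ h₂ ▸ .pre _ _⟩

theorem step_target_iff {a : A} {n : ℕ} {μ : Act A} {p : Proc A} :
    Step (target a n) μ p ↔ μ = act a ∧
      (p = .par .nil (fan a n) ∨ ∃ i < n, p = .par (power a 1) (stem a i)) := by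
  constructor
  · intro h
    refine ⟨((pure_target a n).step h).1, ?_⟩
    cases h with
    | parLeft _ h =>
      obtain ⟨-, rfl⟩ := step_power_one_iff.1 h
      exact .inl rfl
    | parRight _ h =>
      obtain ⟨-, i, hi, rfl⟩ := step_fan_iff.1 h
      exact .inr ⟨i, hi, rfl⟩
    | comm h h' => exact ((pure_target a n).uses.not_comm h h').elim
  · rintro ⟨rfl, rfl | ⟨i, hi, rfl⟩⟩
    · exact .parLeft _ (step_power_one_iff.2 ⟨rfl, rfl⟩)
    · exact .parRight _ (step_fan_iff.2 ⟨rfl, i, hi, rfl⟩)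

/-- Each step of the process can be matched by `a ∥ fan a n`. -/
def Below (a : A) (n : ℕ) (p : Proc A) : Prop :=
  ∀ μ p', Step p μ p' → μ = act a ∧ ∃ x, Step (target a n) (act a) x ∧ WeakBisimilar p' x

theorem Below.not_tau {a : A} {n : ℕ} {p r : Proc A} (h : Below a n p) : ¬ Step p .tau r := by
  intro hs
  cases (h _ _ hs).1

/-- The matching weak transition has no leading silent steps, and the trailing ones are absorbed by
a pure derivative of the target. -/
theorem Below.rooted {a : A} {n : ℕ} {p q : Proc A} (h : Below a n p)
    (hpq : RootedWeakBisimilar p q) : Below a n q := by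
  intro μ q' hs
  obtain ⟨p', ⟨r, s, h₁, h₂, h₃⟩, e⟩ := hpq.2 _ _ hs
  obtain rfl := h₁.eq_of_stable fun _ => h.not_tau
  obtain ⟨rfl, x, hx, hx'⟩ := h _ _ h₂
  exact ⟨rfl, x, hx, e.trans (hx'.of_silent ((pure_target a n).step hx).2 h₃)⟩

theorem Below.uses {a : A} {n : ℕ} {p : Proc A} (h : Below a n p) : Uses a p := by
  by_contra hp
  obtain ⟨μ, p', h₁, h₂, -⟩ := exists_step_depth_eq _ _ hp
  obtain ⟨rfl, x, hx, hx'⟩ := h _ _ h₁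
  have h₃ : Uses a p' := hx'.symm.uses ((pure_target a n).step hx).2.uses
  unfold Uses at *
  rw [h₃] at h₂
  simp [Act.weight, foreignWeight] at h₂
  omega

/-- Inheritance by summands is the reason for a one-sided condition; equivalence to the target would
not be inherited. -/
theorem Below.addLeft {a : A} {n : ℕ} {p q : Proc A} (h : Below a n (.add p q)) : Below a n p :=
  fun _ _ hs => h _ _ (.addLeft q hs)

theorem Below.addRight {a : A} {n : ℕ} {p q : Proc A} (h : Below a n (.add p q)) : Below a n q :=
  fun _ _ hs => h _ _ (.addRight p hs)

theorem Below.parLeft {a : A} {n : ℕ} {p q : Proc A} (h : Below a n (.par p q))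
    (hq : q.len = 0) : Below a n p := by
  intro μ p' hs
  obtain ⟨h₁, x, h₂, h₃⟩ := h _ _ (.parLeft q hs)
  exact ⟨h₁, x, h₂, (WeakBisimilar.par_of_len_eq_zero p' hq).symm.trans h₃⟩

theorem Below.parRight {a : A} {n : ℕ} {p q : Proc A} (h : Below a n (.par p q))
    (hp : p.len = 0) : Below a n q := by
  intro μ q' hs
  obtain ⟨h₁, x, h₂, h₃⟩ := h _ _ (.parRight p hs)
  exact ⟨h₁, x, h₂, (WeakBisimilar.par_of_len_eq_zero q' hp).symm.trans
    ((WeakBisimilar.par_comm _ _).trans h₃)⟩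

/-- A process without any transitions. -/
def Inert (p : Proc A) : Prop := ∀ μ p', ¬ Step p μ p'

theorem Inert.len_eq_zero {p : Proc A} (h : Inert p) : p.len = 0 := by
  by_contra hp
  obtain ⟨μ, p', h₁, -⟩ := exists_step_depth_eq _ _ hp
  exact h _ _ h₁

theorem inert_of_len_eq_zero {p : Proc A} (h : p.len = 0) (ht : ∀ r, ¬ Step p .tau r) :
    Inert p := by
  intro μ p' hs
  cases μ with
  | tau => exact ht _ hs
  | vis α => exact absurd hs.len_lt (by omega)

theorem RootedWeakBisimilar.inert {p q : Proc A} (h : RootedWeakBisimilar p q) (hp : Inert p) :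
    Inert q := by
  intro μ q' hs
  obtain ⟨p', ⟨r, s, h₁, h₂, h₃⟩, -⟩ := h.2 _ _ hs
  obtain rfl := h₁.eq_of_stable fun _ => hp _ _
  exact hp _ _ h₂

theorem WeakBisimilar.power_one_of_len {a : A} {p : Proc A}
    (h : ∀ μ p', Step p μ p' → μ = act a) (hp : p.len = 1) : WeakBisimilar p (power a 1) := by
  have hlen : ∀ {p'}, Step p (act a) p' → WeakBisimilar p' .nil := fun {p'} hs =>
    .of_len_eq_zero (by have := hs.len_lt; omega) rfl
  refine RootedWeakBisimilar.weakBisimilar ⟨fun μ p' hs => ?_, fun μ p' hs => ?_⟩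
  · obtain rfl := h _ _ hs
    exact ⟨.nil, (step_power_one_iff.2 ⟨rfl, rfl⟩).strictWeakStep, hlen hs⟩
  · obtain ⟨rfl, rfl⟩ := step_power_one_iff.1 hs
    obtain ⟨μ, p', h₁, -⟩ := exists_step_depth_eq (fun _ => 1) p (by rw [← Term.len]; omega)
    obtain rfl := h _ _ h₁
    exact ⟨p', h₁.strictWeakStep, (hlen h₁).symm⟩

/-- Unique parallel decomposition of `a ∥ fan a n`. -/
theorem decomposition_target {a : A} {n : ℕ} {p q : Proc A} (h : Below a n (.par p q))
    (hp : ¬ Inert p) (hq : ¬ Inert q) (e : WeakBisimilar (.par p q) (target a n)) :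
    (WeakBisimilar p (power a 1) ∧ WeakBisimilar q (fan a n)) ∨
      (WeakBisimilar p (fan a n) ∧ WeakBisimilar q (power a 1)) := by
  have hp0 : p.len ≠ 0 := fun h0 => hp (inert_of_len_eq_zero h0 fun r hr =>
    h.not_tau (.parLeft q hr))
  have hq0 : q.len ≠ 0 := fun h0 => hq (inert_of_len_eq_zero h0 fun r hr =>
    h.not_tau (.parRight p hr))
  have hlen : p.len + q.len = 1 + (fan a n).len := e.depth_eq _
  -- Matching the lone a of the target leaves a process equivalent to the prime `fan a n`. The idle
  -- component has positive length, so it is the fan, and length 1 remains for the other.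
  obtain ⟨r, h₁, h₂⟩ := e.match_pure_of_stable (pure_target a n)
    (step_target_iff.2 ⟨rfl, .inl rfl⟩) fun _ => h.not_tau
  have h₃ : WeakBisimilar r (fan a n) :=
    h₂.trans ((WeakBisimilar.par_comm _ _).trans (WeakBisimilar.par_of_len_eq_zero _ rfl))
  cases h₁ with
  | @parLeft _ _ p' _ hs =>
    have h0 := (parPrime_fan a n _ _ h₃).resolve_right hq0
    have hqf : WeakBisimilar q (fan a n) := (WeakBisimilar.par_of_len_eq_zero q h0).symm.trans
      ((WeakBisimilar.par_comm _ _).trans h₃)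
    have hl : q.len = (fan a n).len := hqf.depth_eq _
    exact .inl ⟨.power_one_of_len (fun μ p' hs => (h _ _ (.parLeft q hs)).1) (by omega), hqf⟩
  | @parRight _ _ q' _ hs =>
    have h0 := (parPrime_fan a n _ _ h₃).resolve_left hp0
    have hpf : WeakBisimilar p (fan a n) :=
      (WeakBisimilar.par_of_len_eq_zero p h0).symm.trans h₃
    have hl : p.len = (fan a n).len := hpf.depth_eq _
    exact .inr ⟨hpf, .power_one_of_len (fun μ p' hs => (h _ _ (.parRight p hs)).1) (by omega)⟩

/-- A process with steps to two different stems cannot be some `a ∥ stem a m`. -/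
theorem eq_of_step_stem {a : A} {m i : ℕ} {p p' : Proc A}
    (h : WeakBisimilar p (.par (power a 1) (stem a m))) (hs : Step p (act a) p')
    (h' : WeakBisimilar p' (stem a i)) : i = m := by
  have hpure : Pure a (.par (power a 1) (stem a m)) := ⟨pure_power a 1, pure_stem a m⟩
  obtain ⟨x, h₁, h₂⟩ := h.of_vis hpure hs
  have h₃ := h₂.symm.trans h'
  have h₄ : x.len = i + 2 := (h₃.depth_eq _).trans (len_stem a i)
  cases h₁ with
  | parLeft _ hs =>
    obtain ⟨-, rfl⟩ := step_power_one_iff.1 hs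
    have := len_stem a m
    simp only [Term.len, Term.depth] at *
    omega
  | parRight _ hs =>
    have h₅ := len_power a 1
    obtain ⟨-, rfl | rfl⟩ := step_stem_iff.1 hs
    · simp only [Term.len, Term.depth] at *
      omega
    -- The derivative a ∥ a^(m+1) has two visible components, while stems are prime.
    · have h₆ := len_power a (m + 1)
      rcases parPrime_stem a i _ _ h₃ with h₇ | h₇ <;> omega

/-! ### Unguarded subterms -/

/-- `Unguarded t s r`: the term `s` occurs in `t` under sums and parallel compositions only, and
`r` is the parallel composition of the components next to it. -/
inductive Unguarded : Term A V → Term A V → Term A V → Prop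
  | refl (t : Term A V) : Unguarded t t .nil
  | addLeft {t s r : Term A V} (v : Term A V) (h : Unguarded t s r) : Unguarded (.add t v) s r
  | addRight {t s r : Term A V} (v : Term A V) (h : Unguarded t s r) : Unguarded (.add v t) s r
  | parLeft {t s r : Term A V} (v : Term A V) (h : Unguarded t s r) :
      Unguarded (.par t v) s (.par r v)
  | parRight {t s r : Term A V} (v : Term A V) (h : Unguarded t s r) :
      Unguarded (.par v t) s (.par r v)

theorem WeakBisimilar.par_rotate (p q r : Proc A) :
    WeakBisimilar (.par r (.par p q)) (.par p (.par q r)) :=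
  (par_comm _ _).trans (par_assoc _ _ _)

theorem Unguarded.fire {t s r : Term A V} (h : Unguarded t s r) {σ : V → Proc A} {μ : Act A}
    {s' : Proc A} (hs : Step (s.subst σ) μ s') :
    ∃ t', Step (t.subst σ) μ t' ∧ WeakBisimilar t' (.par s' (r.subst σ)) := by
  induction h with
  | refl t => exact ⟨s', hs, (WeakBisimilar.par_of_len_eq_zero _ rfl).symm⟩
  | addLeft v _ ih =>
    obtain ⟨t', h₁, h₂⟩ := ih hs
    exact ⟨t', .addLeft _ h₁, h₂⟩
  | addRight v _ ih =>
    obtain ⟨t', h₁, h₂⟩ := ih hs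
    exact ⟨t', .addRight _ h₁, h₂⟩
  | parLeft v _ ih =>
    obtain ⟨t', h₁, h₂⟩ := ih hs
    exact ⟨_, .parLeft _ h₁, (h₂.par_left _).trans (.par_assoc _ _ _)⟩
  | parRight v _ ih =>
    obtain ⟨t', h₁, h₂⟩ := ih hs
    exact ⟨_, .parRight _ h₁, (WeakBisimilar.par (.refl _) h₂).trans (.par_rotate _ _ _)⟩

/-- Used contrapositively: if an instance of the term has no silent step, neither has the context.
-/
theorem Unguarded.step_rest {t s r : Term A V} (h : Unguarded t s r) {σ : V → Proc A} {μ : Act A}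
    {r' : Proc A} (hs : Step (r.subst σ) μ r') : ∃ t', Step (t.subst σ) μ t' := by
  induction h generalizing μ r' with
  | refl t => cases hs
  | addLeft v _ ih =>
    obtain ⟨t', h₁⟩ := ih hs
    exact ⟨t', .addLeft _ h₁⟩
  | addRight v _ ih =>
    obtain ⟨t', h₁⟩ := ih hs
    exact ⟨t', .addRight _ h₁⟩
  | parLeft v _ ih =>
    cases hs with
    | parLeft _ hs =>
      obtain ⟨t', h₁⟩ := ih hs
      exact ⟨_, .parLeft _ h₁⟩
    | parRight _ hs => exact ⟨_, .parRight _ hs⟩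
    | comm hs hs' =>
      obtain ⟨t', h₁⟩ := ih hs
      exact ⟨_, .comm h₁ hs'⟩
  | parRight v _ ih =>
    cases hs with
    | parLeft _ hs =>
      obtain ⟨t', h₁⟩ := ih hs
      exact ⟨_, .parRight _ h₁⟩
    | parRight _ hs => exact ⟨_, .parLeft _ hs⟩
    | comm hs hs' =>
      obtain ⟨t', h₁⟩ := ih hs
      exact ⟨_, .comm hs' (by rwa [Label.bar_bar])⟩

theorem Unguarded.size_le {t s r : Term A V} (h : Unguarded t s r) : s.size ≤ t.size := by
  induction h <;> simp only [Term.size, le_refl] at * <;> omega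

theorem Unguarded.trans {t s r v r' : Term A V} (h : Unguarded t s r) (h' : Unguarded s v r') :
    ∃ r'', Unguarded t v r'' ∧
      ∀ σ : V → Proc A, (r''.subst σ).len = (r'.subst σ).len + (r.subst σ).len := by
  induction h with
  | refl t => exact ⟨r', h', fun _ => rfl⟩
  | addLeft _ _ ih =>
    obtain ⟨r'', h₁, h₂⟩ := ih h'
    exact ⟨r'', h₁.addLeft _, h₂⟩
  | addRight _ _ ih =>
    obtain ⟨r'', h₁, h₂⟩ := ih h'
    exact ⟨r'', h₁.addRight _, h₂⟩
  | parLeft w _ ih =>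
    obtain ⟨r'', h₁, h₂⟩ := ih h'
    refine ⟨_, h₁.parLeft w, fun σ => ?_⟩
    have := h₂ σ
    simp only [Term.subst, Term.len, Term.depth] at *
    omega
  | parRight w _ ih =>
    obtain ⟨r'', h₁, h₂⟩ := ih h'
    refine ⟨_, h₁.parRight w, fun σ => ?_⟩
    have := h₂ σ
    simp only [Term.subst, Term.len, Term.depth] at *
    omega

/-! ### Steps of substitution instances -/

/-- A process as an open term. -/
def Term.ofProc (p : Proc A) : Term A V := p.subst Empty.elim

theorem Term.subst_ofProc (p : Proc A) (σ : V → Proc A) :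
    (Term.ofProc p : Term A V).subst σ = p := by
  unfold Term.ofProc
  induction p with
  | var x => exact x.elim
  | _ => simp_all [Term.subst]

-- A visible step is not a communication, so it has a single origin: the value of an unguarded `x`,
-- or something else, in which case it survives any change of that value.
open Function Classical in
theorem step_subst_vis {σ : V → Proc A} {x : V} {p : Proc A} {α : Label A} (t : Term A V)
    {r : Proc A} (h : Step (t.subst (update σ x p)) (.vis α) r) :
    (∃ t' : Term A V, r = t'.subst (update σ x p) ∧
      ∀ q, Step (t.subst (update σ x q)) (.vis α) (t'.subst (update σ x q))) ∨
    ∃ s p', Unguarded t (.var x) s ∧ Step p (.vis α) p' ∧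
      WeakBisimilar r (.par p' (s.subst (update σ x p))) := by
  induction t generalizing r with
  | nil => cases h
  | var y =>
    by_cases hy : y = x
    · subst hy
      simp only [Term.subst, update_self] at h
      exact .inr ⟨.nil, r, .refl _, h, (WeakBisimilar.par_of_len_eq_zero _ rfl).symm⟩
    · simp only [Term.subst, update_of_ne hy] at h
      refine .inl ⟨.ofProc r, (Term.subst_ofProc _ _).symm, fun q => ?_⟩
      simpa only [Term.subst, update_of_ne hy, Term.subst_ofProc] using h
  | pre μ t =>
    cases h
    exact .inl ⟨t, rfl, fun q => .pre _ _⟩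
  | add t v iht ihv =>
    cases h with
    | addLeft _ h =>
      rcases iht h with ⟨t', h₁, h₂⟩ | ⟨s, p', h₁, h₂⟩
      · exact .inl ⟨t', h₁, fun q => .addLeft _ (h₂ q)⟩
      · exact .inr ⟨s, p', h₁.addLeft _, h₂⟩
    | addRight _ h =>
      rcases ihv h with ⟨t', h₁, h₂⟩ | ⟨s, p', h₁, h₂⟩
      · exact .inl ⟨t', h₁, fun q => .addRight _ (h₂ q)⟩
      · exact .inr ⟨s, p', h₁.addRight _, h₂⟩
  | par t v iht ihv =>
    cases h with
    | parLeft _ h =>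
      rcases iht h with ⟨t', rfl, h₂⟩ | ⟨s, p', h₁, h₂, h₃⟩
      · exact .inl ⟨.par t' v, rfl, fun q => .parLeft _ (h₂ q)⟩
      · exact .inr ⟨_, p', h₁.parLeft v, h₂, (h₃.par_left _).trans (.par_assoc _ _ _)⟩
    | parRight _ h =>
      rcases ihv h with ⟨t', rfl, h₂⟩ | ⟨s, p', h₁, h₂, h₃⟩
      · exact .inl ⟨.par t t', rfl, fun q => .parRight _ (h₂ q)⟩
      · exact .inr ⟨_, p', h₁.parRight t, h₂,
          (WeakBisimilar.par (.refl _) h₃).trans (.par_rotate _ _ _)⟩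

theorem Uses.of_add {a : A} {p q : Proc A} (h : Uses a (.add p q)) : Uses a p ∧ Uses a q := by
  simpa [Uses, Term.depth] using h

theorem Uses.of_par {a : A} {p q : Proc A} (h : Uses a (.par p q)) : Uses a p ∧ Uses a q := by
  simpa [Uses, Term.depth] using h

-- The two origins that depend on the value of `x`, a silent step of `p` and a communication, are
-- excluded.
open Function Classical in
theorem step_subst_tau {a : A} {σ : V → Proc A} {x : V} {p : Proc A} (t : Term A V) {r : Proc A}
    (ha : Uses a (t.subst (update σ x p))) (hp : ∀ p', ¬ Step p .tau p')
    (h : Step (t.subst (update σ x p)) .tau r) :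
    ∃ t' : Term A V, r = t'.subst (update σ x p) ∧
      ∀ q, Step (t.subst (update σ x q)) .tau (t'.subst (update σ x q)) := by
  induction t generalizing r with
  | nil => cases h
  | var y =>
    by_cases hy : y = x
    · subst hy
      simp only [Term.subst, update_self] at h
      exact (hp _ h).elim
    · simp only [Term.subst, update_of_ne hy] at h
      refine ⟨.ofProc r, (Term.subst_ofProc _ _).symm, fun q => ?_⟩
      simpa only [Term.subst, update_of_ne hy, Term.subst_ofProc] using h
  | pre μ t =>
    cases h
    exact ⟨t, rfl, fun q => .pre _ _⟩
  | add t v iht ihv =>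
    cases h with
    | addLeft _ h =>
      obtain ⟨t', h₁, h₂⟩ := iht ha.of_add.1 h
      exact ⟨t', h₁, fun q => .addLeft _ (h₂ q)⟩
    | addRight _ h =>
      obtain ⟨t', h₁, h₂⟩ := ihv ha.of_add.2 h
      exact ⟨t', h₁, fun q => .addRight _ (h₂ q)⟩
  | par t v iht ihv =>
    cases h with
    | parLeft _ h =>
      obtain ⟨t', rfl, h₂⟩ := iht ha.of_par.1 h
      exact ⟨.par t' v, rfl, fun q => .parLeft _ (h₂ q)⟩
    | parRight _ h =>
      obtain ⟨t', rfl, h₂⟩ := ihv ha.of_par.2 h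
      exact ⟨.par t t', rfl, fun q => .parRight _ (h₂ q)⟩
    | comm h h' => exact (ha.not_comm h h').elim

open Function Classical in
theorem silent_subst {a : A} {σ : V → Proc A} {x : V} {p : Proc A} (t : Term A V) {r : Proc A}
    (ha : Uses a (t.subst (update σ x p))) (hp : ∀ p', ¬ Step p .tau p')
    (h : Silent (t.subst (update σ x p)) r) :
    ∃ t' : Term A V, r = t'.subst (update σ x p) ∧ Uses a r ∧
      ∀ q, Silent (t.subst (update σ x q)) (t'.subst (update σ x q)) := by
  induction h with
  | refl => exact ⟨t, rfl, ha, fun _ => .refl⟩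
  | tail _ hs ih =>
    obtain ⟨t', rfl, h₁, h₂⟩ := ih
    obtain ⟨t'', rfl, h₃⟩ := step_subst_tau t' h₁ hp hs
    exact ⟨t'', rfl, (h₁.step hs).2, fun q => (h₂ q).tail (h₃ q)⟩

open Function Classical in
theorem Uses.subst_update {a : A} {σ : V → Proc A} {x : V} {p : Proc A} {t : Term A V}
    (ht : Uses a (t.subst σ)) (hp : Uses a p) : Uses a (t.subst (update σ x p)) := by
  unfold Uses at *
  induction t with
  | nil => rfl
  | var y =>
    by_cases hy : y = x
    · subst hy
      simpa only [Term.subst, update_self] using hp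
    · simpa only [Term.subst, update_of_ne hy] using ht
  | _ => simp_all [Term.subst, Term.depth]

open Function Classical in
/-- Either a variable is irrelevant for the instances of a term, or its value bounds their
length from below. -/
theorem subst_update_eq_or_len_le (x : V) (t : Term A V) :
    (∀ (σ : V → Proc A) p, t.subst (update σ x p) = t.subst σ) ∨
      ∀ σ : V → Proc A, (σ x).len ≤ (t.subst σ).len := by
  induction t with
  | nil => exact .inl fun _ _ => rfl
  | var y =>
    by_cases hy : y = x
    · subst hy
      exact .inr fun _ => le_rfl
    · exact .inl fun _ _ => by simp only [Term.subst, update_of_ne hy]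
  | pre μ t ih =>
    refine ih.imp (fun h σ p => by simp only [Term.subst, h]) fun h σ => (h σ).trans ?_
    simp [Term.subst, Term.len, Term.depth]
  | add t s iht ihs =>
    rcases iht with h | h
    · refine ihs.imp (fun h' σ p => by simp only [Term.subst, h, h']) fun h σ => (h σ).trans ?_
      simp [Term.subst, Term.len, Term.depth]
    · refine .inr fun σ => (h σ).trans ?_
      simp [Term.subst, Term.len, Term.depth]
  | par t s iht ihs =>
    rcases iht with h | h
    · refine ihs.imp (fun h' σ p => by simp only [Term.subst, h, h']) fun h σ => (h σ).trans ?_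
      simp [Term.subst, Term.len, Term.depth]
    · refine .inr fun σ => (h σ).trans ?_
      simp [Term.subst, Term.len, Term.depth]

open Function Classical in
/-- An unguarded variable with a short context on one side of a sound equation has a context of
the same length on the other side. -/
theorem SoundEquation.exists_unguarded {a : A} {n : ℕ} {t u : Term A V} (hs : SoundEquation t u)
    {σ : V → Proc A} (ht : Below a n (t.subst σ)) {x : V} {r : Term A V}
    (hr : Unguarded t (.var x) r) (h₁ : (r.subst σ).len ≤ 1)
    (hx : (r.subst σ).len < (σ x).len) :
    ∃ r', Unguarded u (.var x) r' ∧ (r'.subst σ).len = (r.subst σ).len := by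
  have hu : Below a n (u.subst σ) := ht.rooted (hs σ)
  -- `M` exceeds all lengths that `u` attains without `x`. The value `p` has a step to length `M`,
  -- yet its own length 2M + 1 exceeds M + 1, so a residual of length at most M + 1 cannot contain
  -- `x`. The summand 2 also gives 2M > M + 1.
  set M := (u.subst (update σ x .nil)).len + 2 with hM
  set p : Proc A := .add (power a (M + 1)) (power a (2 * M + 1)) with hpdef
  have hpp : Pure a p := ⟨pure_power a _, pure_power a _⟩
  have hptau : ∀ p', ¬ Step p .tau p' := fun _ => hpp.not_tau
  have hplen : p.len = 2 * M + 1 := by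
    have e₁ := len_power a (M + 1)
    have e₂ := len_power a (2 * M + 1)
    simp only [hpdef, Term.len, Term.depth] at *
    omega
  have hself : update σ x (σ x) = σ := update_eq_self x σ
  have hur : Uses a (u.subst (update σ x p)) := hu.uses.subst_update hpp.uses
  have hutau : ∀ r, ¬ Step (u.subst (update σ x p)) .tau r := by
    intro r hstep
    obtain ⟨u', -, h⟩ := step_subst_tau u hur hptau hstep
    have := h (σ x)
    rw [hself] at this
    exact hu.not_tau this
  -- The context is shorter than `σ x`, so `x` does not occur in it.
  have hreq : r.subst (update σ x p) = r.subst σ := by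
    rcases subst_update_eq_or_len_le x r with h | h
    · exact h σ p
    · exact absurd (h σ) (by omega)
  obtain ⟨t', ht', hte⟩ := hr.fire (σ := update σ x p) (μ := act a) (s' := power a M)
    (by simp only [Term.subst, update_self]; exact .addLeft _ (.pre _ _))
  obtain ⟨q, ⟨u₁, u₂, k₁, k₂, k₃⟩, hq⟩ := (hs _).1 _ _ ht'
  obtain rfl := k₁.eq_of_stable hutau
  have hqlen : q.len = M + (r.subst σ).len := by
    have e₁ : q.len = _ := hq.symm.depth_eq _
    have e₂ : t'.len = _ := hte.depth_eq _
    have e₃ := len_power a M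
    rw [hreq] at e₂
    simp only [Term.len, Term.depth] at *
    omega
  rcases step_subst_vis u k₂ with ⟨u', rfl, h⟩ | ⟨r', p', hr', hp', e⟩
  -- If the step does not come from `x`, the residual is too short when `x` is irrelevant to it and
  -- too long otherwise.
  · exfalso
    obtain ⟨v, rfl, -, hv⟩ := silent_subst u' (hur.step k₂).2 hptau k₃
    rcases subst_update_eq_or_len_le x v with hvx | hvx
    · have e₁ : (v.subst (update σ x .nil)).len ≤ _ := (hv .nil).depth_le _
      have e₂ := (h .nil).len_lt
      have e₃ : v.subst (update σ x .nil) = v.subst (update σ x p) := by rw [hvx, hvx]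
      rw [← e₃] at hqlen
      simp only [Term.len] at *
      omega
    · have := hvx (update σ x p)
      rw [update_self] at this
      omega
  · have hpure' := (hpp.step hp').2
    have huses : Uses a (.par p' (r'.subst (update σ x p))) := e.uses (hur.step k₂).2
    have hrtau : ∀ s, ¬ Step (.par p' (r'.subst (update σ x p))) .tau s := by
      intro s hstep
      cases hstep with
      | parLeft _ h => exact hpure'.not_tau h
      | parRight _ h =>
        obtain ⟨t', h⟩ := hr'.step_rest h
        exact hutau _ h
      | comm h h' => exact huses.not_comm h h'
    obtain ⟨q', k₄, k₅⟩ := e.silent k₃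
    obtain rfl := k₄.eq_of_stable hrtau
    have hlen : q.len = p'.len + (r'.subst (update σ x p)).len := k₅.depth_eq _
    rcases subst_update_eq_or_len_le x r' with hrx | hrx
    · rw [hrx] at hlen
      refine ⟨r', hr', ?_⟩
      -- The long branch already exceeds the available length; the short one leaves exactly the
      -- length of `r` for `r'`.
      have hcases : p' = power a M ∨ p' = power a (2 * M) := by
        rw [hpdef] at hp'
        rcases hp' with _ | ⟨_, _ | _⟩ | ⟨_, _ | _⟩
        · exact .inl rfl
        · exact .inr rfl
      rcases hcases with rfl | rfl
      · rw [len_power] at hlen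
        omega
      · rw [len_power] at hlen
        omega
    · have := hrx (update σ x p)
      rw [update_self] at this
      omega

/-- A term with more pairwise incompatible steps than symbols owes two of them to the same
unguarded variable. -/
theorem exists_unguarded_var {σ : V → Proc A} {α : Label A} (t : Term A V)
    (Q : ℕ → Proc A → Prop) (hQ : ∀ i p q, WeakBisimilar p q → Q i p → Q i q)
    (hd : ∀ i j p, Q i p → Q j p → i = j) (S : Finset ℕ) (hS : t.size < S.card)
    (h : ∀ i ∈ S, ∃ r, Step (t.subst σ) (.vis α) r ∧ Q i r) :
    ∃ x s i j p q, Unguarded t (.var x) s ∧ i ≠ j ∧ Step (σ x) (.vis α) p ∧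
      Step (σ x) (.vis α) q ∧ Q i (.par p (s.subst σ)) ∧ Q j (.par q (s.subst σ)) := by
  classical
  induction t generalizing Q S with
  | nil =>
    obtain ⟨i, hi⟩ := Finset.card_pos.1 (by omega : 0 < S.card)
    obtain ⟨r, hr, -⟩ := h i hi
    cases hr
  | var x =>
    obtain ⟨i, hi, j, hj, hij⟩ := Finset.one_lt_card.1 hS
    obtain ⟨p, hp, hp'⟩ := h i hi
    obtain ⟨q, hq, hq'⟩ := h j hj
    exact ⟨x, .nil, i, j, p, q, .refl _, hij, hp, hq,
      hQ _ _ _ (WeakBisimilar.par_of_len_eq_zero _ rfl).symm hp',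
      hQ _ _ _ (WeakBisimilar.par_of_len_eq_zero _ rfl).symm hq'⟩
  | pre μ t _ =>
    obtain ⟨i, hi, j, hj, hij⟩ := Finset.one_lt_card.1
      (lt_of_le_of_lt (by simp [Term.size]) hS : 1 < S.card)
    obtain ⟨p, hp, hp'⟩ := h i hi
    obtain ⟨q, hq, hq'⟩ := h j hj
    cases hp
    cases hq
    exact (hij (hd _ _ _ hp' hq')).elim
  | add t v iht ihv =>
    set S₁ := S.filter fun i => ∃ r, Step (t.subst σ) (.vis α) r ∧ Q i r with hS₁
    set S₂ := S.filter fun i => ∃ r, Step (v.subst σ) (.vis α) r ∧ Q i r with hS₂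
    have hsub : S ⊆ S₁ ∪ S₂ := by
      intro i hi
      obtain ⟨r, hr, hr'⟩ := h i hi
      cases hr with
      | addLeft _ hr => exact Finset.mem_union_left _ (Finset.mem_filter.2 ⟨hi, _, hr, hr'⟩)
      | addRight _ hr => exact Finset.mem_union_right _ (Finset.mem_filter.2 ⟨hi, _, hr, hr'⟩)
    have hcard := (Finset.card_le_card hsub).trans (Finset.card_union_le _ _)
    simp only [Term.size] at hS
    by_cases hlt : t.size < S₁.card
    · obtain ⟨x, s, i, j, p, q, h₁, h₂⟩ :=
        iht Q hQ hd S₁ hlt fun i hi => (Finset.mem_filter.1 hi).2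
      exact ⟨x, s, i, j, p, q, h₁.addLeft v, h₂⟩
    · obtain ⟨x, s, i, j, p, q, h₁, h₂⟩ :=
        ihv Q hQ hd S₂ (by omega) fun i hi => (Finset.mem_filter.1 hi).2
      exact ⟨x, s, i, j, p, q, h₁.addRight t, h₂⟩
  | par t v iht ihv =>
    -- Each component is judged together with its idle neighbour. This keeps the predicates
    -- invariant and disjoint, and one component gets more indices than it has symbols.
    set S₁ := S.filter fun i => ∃ r, Step (t.subst σ) (.vis α) r ∧ Q i (.par r (v.subst σ))
      with hS₁
    set S₂ := S.filter fun i => ∃ r, Step (v.subst σ) (.vis α) r ∧ Q i (.par (t.subst σ) r)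
      with hS₂
    have hsub : S ⊆ S₁ ∪ S₂ := by
      intro i hi
      obtain ⟨r, hr, hr'⟩ := h i hi
      cases hr with
      | parLeft _ hr => exact Finset.mem_union_left _ (Finset.mem_filter.2 ⟨hi, _, hr, hr'⟩)
      | parRight _ hr => exact Finset.mem_union_right _ (Finset.mem_filter.2 ⟨hi, _, hr, hr'⟩)
    have hcard := (Finset.card_le_card hsub).trans (Finset.card_union_le _ _)
    simp only [Term.size] at hS
    by_cases hlt : t.size < S₁.card
    · obtain ⟨x, s, i, j, p, q, h₁, h₂, h₃, h₄, h₅, h₆⟩ :=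
        iht (fun i r => Q i (.par r (v.subst σ))) (fun i p q e => hQ _ _ _ (e.par_left _))
          (fun i j p => hd i j _) S₁ hlt fun i hi => (Finset.mem_filter.1 hi).2
      exact ⟨x, _, i, j, p, q, h₁.parLeft v, h₂, h₃, h₄,
        hQ _ _ _ (.par_assoc _ _ _) h₅, hQ _ _ _ (.par_assoc _ _ _) h₆⟩
    · obtain ⟨x, s, i, j, p, q, h₁, h₂, h₃, h₄, h₅, h₆⟩ :=
        ihv (fun i r => Q i (.par (t.subst σ) r)) (fun i p q e => hQ _ _ _ (.par (.refl _) e))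
          (fun i j p => hd i j _) S₂ (by omega) fun i hi => (Finset.mem_filter.1 hi).2
      exact ⟨x, _, i, j, p, q, h₁.parRight t, h₂, h₃, h₄,
        hQ _ _ _ (.par_rotate _ _ _) h₅, hQ _ _ _ (.par_rotate _ _ _) h₆⟩

/-! ### The invariant of equational proofs -/

/-- Up to inert parallel components, the process has a summand that is a parallel composition of
two non-inert processes and is weakly bisimilar to `a ∥ fan a n`. -/
inductive HasTarget (a : A) (n : ℕ) : Proc A → Prop
  | addLeft {p : Proc A} (q : Proc A) (h : HasTarget a n p) : HasTarget a n (.add p q)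
  | addRight {q : Proc A} (p : Proc A) (h : HasTarget a n q) : HasTarget a n (.add p q)
  | parLeft {p q : Proc A} (hq : Inert q) (h : HasTarget a n p) : HasTarget a n (.par p q)
  | parRight {p q : Proc A} (hp : Inert p) (h : HasTarget a n q) : HasTarget a n (.par p q)
  | par {p q : Proc A} (hp : ¬ Inert p) (hq : ¬ Inert q)
      (h : WeakBisimilar (.par p q) (target a n)) : HasTarget a n (.par p q)

theorem len_target (a : A) (n : ℕ) : (target a n).len = 1 + (fan a n).len := rfl

theorem HasTarget.len_pos {a : A} {n : ℕ} {p : Proc A} (h : HasTarget a n p) : 0 < p.len := by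
  induction h with
  | par _ _ h =>
    have := h.depth_eq fun _ => 1
    have := len_target a n
    simp only [Term.len] at *
    omega
  | _ => simp only [Term.len, Term.depth] at *; omega

theorem Unguarded.hasTarget {a : A} {n : ℕ} {t s r : Term A V} {σ : V → Proc A}
    (h : Unguarded t s r) (hr : Inert (r.subst σ)) (hs : HasTarget a n (s.subst σ)) :
    HasTarget a n (t.subst σ) := by
  induction h with
  | refl t => exact hs
  | addLeft v _ ih => exact .addLeft _ (ih hr hs)
  | addRight v _ ih => exact .addRight _ (ih hr hs)
  | parLeft v _ ih =>
    exact .parLeft (fun _ _ h => hr _ _ (.parRight _ h))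
      (ih (fun _ _ h => hr _ _ (.parLeft _ h)) hs)
  | parRight v _ ih =>
    exact .parRight (fun _ _ h => hr _ _ (.parRight _ h))
      (ih (fun _ _ h => hr _ _ (.parLeft _ h)) hs)

theorem Inert.par {p q : Proc A} (hp : Inert p) (hq : Inert q) : Inert (.par p q) := by
  intro μ r h
  cases h with
  | parLeft _ h => exact hp _ _ h
  | parRight _ h => exact hq _ _ h
  | comm h _ => exact hp _ _ h

theorem HasTarget.exists_unguarded {a : A} {n : ℕ} {σ : V → Proc A} (t : Term A V)
    (h : HasTarget a n (t.subst σ)) :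
    (∃ x r, Unguarded t (.var x) r ∧ Inert (r.subst σ) ∧ HasTarget a n (σ x)) ∨
      ∃ t₁ t₂ r, Unguarded t (.par t₁ t₂) r ∧ Inert (r.subst σ) ∧ ¬ Inert (t₁.subst σ) ∧
        ¬ Inert (t₂.subst σ) ∧
        WeakBisimilar (.par (t₁.subst σ) (t₂.subst σ)) (target a n) := by
  induction t with
  | nil => cases h
  | var x => exact .inl ⟨x, .nil, .refl _, (fun _ _ h => by cases h), h⟩
  | pre μ t => cases h
  | add t v iht ihv =>
    cases h with
    | addLeft _ h =>
      exact (iht h).imp (fun ⟨x, r, h₁, h₂⟩ => ⟨x, r, h₁.addLeft _, h₂⟩)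
        fun ⟨t₁, t₂, r, h₁, h₂⟩ => ⟨t₁, t₂, r, h₁.addLeft _, h₂⟩
    | addRight _ h =>
      exact (ihv h).imp (fun ⟨x, r, h₁, h₂⟩ => ⟨x, r, h₁.addRight _, h₂⟩)
        fun ⟨t₁, t₂, r, h₁, h₂⟩ => ⟨t₁, t₂, r, h₁.addRight _, h₂⟩
  | par t v iht ihv =>
    cases h with
    | parLeft hi h =>
      exact (iht h).imp (fun ⟨x, r, h₁, h₂, h₃⟩ => ⟨x, _, h₁.parLeft v, h₂.par hi, h₃⟩)
        fun ⟨t₁, t₂, r, h₁, h₂, h₃⟩ => ⟨t₁, t₂, _, h₁.parLeft v, h₂.par hi, h₃⟩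
    | parRight hi h =>
      exact (ihv h).imp (fun ⟨x, r, h₁, h₂, h₃⟩ => ⟨x, _, h₁.parRight t, h₂.par hi, h₃⟩)
        fun ⟨t₁, t₂, r, h₁, h₂, h₃⟩ => ⟨t₁, t₂, _, h₁.parRight t, h₂.par hi, h₃⟩
    | par h₁ h₂ h₃ =>
      exact .inr ⟨t, v, .nil, .refl _, (fun _ _ h => by cases h), h₁, h₂, h₃⟩

/-- If `p` has steps to two different stems and `q` is of length one, then a parallel composition
of `p` and `q` whose steps are matched by `a ∥ fan a n` is weakly bisimilar to it. -/
theorem weakBisimilar_target_of_step {a : A} {n : ℕ} {p q p₁ p₂ : Proc A} {i j : ℕ}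
    (h : Below a n (.par p q)) (hij : i ≠ j) (hq : q.len = 1)
    (h₁ : Step p (act a) p₁) (e₁ : WeakBisimilar p₁ (stem a i))
    (h₂ : Step p (act a) p₂) (e₂ : WeakBisimilar p₂ (stem a j)) :
    WeakBisimilar (.par p q) (target a n) := by
  have hq1 : WeakBisimilar q (power a 1) :=
    .power_one_of_len (fun μ q' hs => (h _ _ (.parRight p hs)).1) hq
  obtain ⟨μ, q', hs, -⟩ := exists_step_depth_eq (fun _ => 1) q (by rw [← Term.len]; omega)
  -- Once `q` has spent its only visible action, `p` itself is equivalent to a derivative of the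
  -- target: the fan, or some a ∥ `stem a m`, which cannot reach two different stems.
  obtain ⟨rfl, x, hx, hx'⟩ := h _ _ (.parRight p hs)
  have hp : WeakBisimilar p x := (WeakBisimilar.par_of_len_eq_zero p
    (by have := hs.len_lt; omega)).symm.trans hx'
  obtain ⟨-, rfl | ⟨m, -, rfl⟩⟩ := step_target_iff.1 hx
  · exact (WeakBisimilar.par_comm _ _).trans (hq1.par (hp.trans
      ((WeakBisimilar.par_comm _ _).trans (WeakBisimilar.par_of_len_eq_zero _ rfl))))
  · exact (hij ((eq_of_step_stem hp h₁ e₁).trans (eq_of_step_stem hp h₂ e₂).symm)).elim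

theorem Below.par_swap {a : A} {n : ℕ} {p q : Proc A} (h : Below a n (.par p q)) :
    Below a n (.par q p) := by
  intro μ r hs
  obtain ⟨p', q', rfl, hs'⟩ := hs.par_swap
  obtain ⟨h₁, x, h₂, h₃⟩ := h _ _ hs'
  exact ⟨h₁, x, h₂, (WeakBisimilar.par_comm _ _).trans h₃⟩

theorem Unguarded.weakBisimilar_target {a : A} {n : ℕ} {t s r v : Term A V} {σ : V → Proc A}
    {p₁ p₂ : Proc A} {i j : ℕ} (h : Unguarded t s r)
    (hb : Below a n (.par (t.subst σ) (v.subst σ)))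
    (hr : (r.subst σ).len + (v.subst σ).len = 1) (hv : (v.subst σ).len ≠ 0) (hij : i ≠ j)
    (h₁ : Step (s.subst σ) (act a) p₁) (e₁ : WeakBisimilar p₁ (stem a i))
    (h₂ : Step (s.subst σ) (act a) p₂) (e₂ : WeakBisimilar p₂ (stem a j)) :
    ¬ Inert (t.subst σ) ∧ ¬ Inert (v.subst σ) ∧
      WeakBisimilar (.par (t.subst σ) (v.subst σ)) (target a n) := by
  have hr0 : (r.subst σ).len = 0 := by omega
  obtain ⟨t₁, k₁, d₁⟩ := h.fire h₁
  obtain ⟨t₂, k₂, d₂⟩ := h.fire h₂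
  refine ⟨fun hi => hi _ _ k₁, fun hi => hv hi.len_eq_zero, ?_⟩
  exact weakBisimilar_target_of_step hb hij (by omega)
    k₁ (d₁.trans ((WeakBisimilar.par_of_len_eq_zero _ hr0).trans e₁))
    k₂ (d₂.trans ((WeakBisimilar.par_of_len_eq_zero _ hr0).trans e₂))

/-- On the way down to `s`, siblings of length zero are inert, since there are no silent steps. As
the context has length 1, some sibling has length 1, and there the two stems identify the target. -/
theorem Unguarded.hasTarget_of_step {a : A} {n : ℕ} {u s r : Term A V} {σ : V → Proc A}
    {p₁ p₂ : Proc A} {i j : ℕ} (h : Unguarded u s r) (hu : Below a n (u.subst σ))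
    (hr : (r.subst σ).len = 1) (hij : i ≠ j)
    (h₁ : Step (s.subst σ) (act a) p₁) (e₁ : WeakBisimilar p₁ (stem a i))
    (h₂ : Step (s.subst σ) (act a) p₂) (e₂ : WeakBisimilar p₂ (stem a j)) :
    HasTarget a n (u.subst σ) := by
  induction h with
  | refl t => simp [Term.subst, Term.len, Term.depth] at hr
  | addLeft v _ ih => exact .addLeft _ (ih hu.addLeft hr h₁ h₂)
  | addRight v _ ih => exact .addRight _ (ih hu.addRight hr h₁ h₂)
  | parLeft v h ih =>
    by_cases hv : (v.subst σ).len = 0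
    · refine .parLeft (inert_of_len_eq_zero hv fun _ hs => hu.not_tau (.parRight _ hs))
        (ih (hu.parLeft hv) ?_ h₁ h₂)
      simp only [Term.subst, Term.len, Term.depth] at *
      omega
    · obtain ⟨k₁, k₂, k₃⟩ := h.weakBisimilar_target hu hr hv hij h₁ e₁ h₂ e₂
      exact .par k₁ k₂ k₃
  | parRight v h ih =>
    by_cases hv : (v.subst σ).len = 0
    · refine .parRight (inert_of_len_eq_zero hv fun _ hs => hu.not_tau (.parLeft _ hs))
        (ih (hu.parRight hv) ?_ h₁ h₂)
      simp only [Term.subst, Term.len, Term.depth] at *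
      omega
    · obtain ⟨k₁, k₂, k₃⟩ := h.weakBisimilar_target hu.par_swap hr hv hij h₁ e₁ h₂ e₂
      exact .par k₂ k₁ ((WeakBisimilar.par_comm _ _).trans k₃)

theorem Unguarded.below_subst {a : A} {n : ℕ} {t s r : Term A V} {σ : V → Proc A}
    (h : Unguarded t s r) (hr : (r.subst σ).len = 0) (ht : Below a n (t.subst σ)) :
    Below a n (s.subst σ) := by
  intro μ s' hs
  obtain ⟨t', h₁, h₂⟩ := h.fire hs
  obtain ⟨h₃, x, h₄, h₅⟩ := ht _ _ h₁
  exact ⟨h₃, x, h₄, (WeakBisimilar.par_of_len_eq_zero _ hr).symm.trans (h₂.symm.trans h₅)⟩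

/-- A small term with an instance weakly bisimilar to `fan a n` has an unguarded variable, without
visible behaviour next to it, whose value has steps to two different stems. -/
theorem exists_unguarded_var_of_fan {a : A} {n : ℕ} {t : Term A V} {σ : V → Proc A}
    (hsize : t.size < n) (ht : WeakBisimilar (t.subst σ) (fan a n))
    (htau : ∀ r, ¬ Step (t.subst σ) .tau r) :
    ∃ x r i j p q, Unguarded t (.var x) r ∧ (r.subst σ).len = 0 ∧ i ≠ j ∧
      Step (σ x) (act a) p ∧ WeakBisimilar p (stem a i) ∧
      Step (σ x) (act a) q ∧ WeakBisimilar q (stem a j) := by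
  obtain ⟨x, r, i, j, p, q, h₁, hij, h₂, h₃, h₄, h₅⟩ := exists_unguarded_var (σ := σ)
    (α := .name a) t (fun i r => WeakBisimilar r (stem a i)) (fun _ _ _ e h => e.symm.trans h)
    (fun i j p h h' => by
      have e : (stem a i).len = (stem a j).len := (h.symm.trans h').depth_eq _
      rw [len_stem, len_stem] at e
      omega)
    (Finset.range n) (by simpa using hsize)
    (fun i hi => ht.match_pure_of_stable (pure_fan a n)
      (step_fan_iff.2 ⟨rfl, i, Finset.mem_range.1 hi, rfl⟩) htau)
  -- Otherwise primality would give `p` and `q` length zero, and the context both lengths i + 2 and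
  -- j + 2.
  have hr : (r.subst σ).len = 0 := by
    have e₁ : p.len + (r.subst σ).len = (stem a i).len := h₄.depth_eq _
    have e₂ : q.len + (r.subst σ).len = (stem a j).len := h₅.depth_eq _
    rw [len_stem] at e₁ e₂
    rcases parPrime_stem a i _ _ h₄ with hp | hr
    · rcases parPrime_stem a j _ _ h₅ with hq | hr
      · omega
      · exact hr
    · exact hr
  exact ⟨x, r, i, j, p, q, h₁, hr, hij, h₂,
    (WeakBisimilar.par_of_len_eq_zero p hr).symm.trans h₄, h₃,
    (WeakBisimilar.par_of_len_eq_zero q hr).symm.trans h₅⟩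

/-- Instances of sound equations between small terms preserve `HasTarget`. -/
theorem SoundEquation.hasTarget {a : A} {n : ℕ} {t u : Term A V} (hs : SoundEquation t u)
    (hsize : t.size < n) {σ : V → Proc A} (ht : Below a n (t.subst σ))
    (h : HasTarget a n (t.subst σ)) : HasTarget a n (u.subst σ) := by
  have hu : Below a n (u.subst σ) := ht.rooted (hs σ)
  rcases HasTarget.exists_unguarded t h with ⟨x, r, h₁, h₂, h₃⟩ | ⟨t₁, t₂, r, h₁, h₂, h₃, h₄, h₅⟩
  · have hr := h₂.len_eq_zero
    obtain ⟨r', h₄, h₅⟩ := hs.exists_unguarded ht h₁ (by omega) (hr ▸ h₃.len_pos)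
    refine h₄.hasTarget (inert_of_len_eq_zero (h₅.trans hr) fun _ hstep => ?_) h₃
    obtain ⟨_, hstep⟩ := h₄.step_rest hstep
    exact hu.not_tau hstep
  · have hr := h₂.len_eq_zero
    have hb := h₁.below_subst hr ht
    -- Here `v` is the component playing the fan and `z` the context made of the other component,
    -- which plays a.
    have main : ∀ v z, Unguarded (.par t₁ t₂) v z → (z.subst σ).len = 1 →
        WeakBisimilar (v.subst σ) (fan a n) → (∀ r, ¬ Step (v.subst σ) .tau r) →
        HasTarget a n (u.subst σ) := by
      intro v z hv hz hvf htau
      obtain ⟨x, s, i, j, p, q, k₁, k₂, hij, k₃, k₄, k₅, k₆⟩ := exists_unguarded_var_of_fan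
        (lt_of_le_of_lt (hv.size_le.trans h₁.size_le) hsize) hvf htau
      obtain ⟨r₁, k₇, k₈⟩ := hv.trans k₁
      obtain ⟨r₂, k₉, k₁₀⟩ := h₁.trans k₇
      have hlen : (r₂.subst σ).len = 1 := by
        rw [k₁₀, k₈]
        omega
      have hp : p.len = i + 2 := (k₄.depth_eq _).trans (len_stem a i)
      obtain ⟨r', d₁, d₂⟩ := hs.exists_unguarded ht k₉ (by omega)
        (by have := k₃.len_lt; omega)
      exact d₁.hasTarget_of_step hu (d₂.trans hlen) hij k₃ k₄ k₅ k₆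
    rcases decomposition_target hb h₃ h₄ h₅ with ⟨e₁, e₂⟩ | ⟨e₁, e₂⟩
    · refine main t₂ _ (.parRight t₁ (.refl t₂)) ?_ e₂ fun _ hr => hb.not_tau (.parRight _ hr)
      exact (Nat.zero_add _).trans ((e₁.depth_eq _).trans (len_power a 1))
    · refine main t₁ _ (.parLeft t₂ (.refl t₁)) ?_ e₁ fun _ hr => hb.not_tau (.parLeft _ hr)
      exact (Nat.zero_add _).trans ((e₂.depth_eq _).trans (len_power a 1))

theorem hasTarget_par_iff {a : A} {n : ℕ} {p q : Proc A} :
    HasTarget a n (.par p q) ↔ (Inert q ∧ HasTarget a n p) ∨ (Inert p ∧ HasTarget a n q) ∨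
      (¬ Inert p ∧ ¬ Inert q ∧ WeakBisimilar (.par p q) (target a n)) := by
  constructor
  · rintro (_ | _ | ⟨h, h'⟩ | ⟨h, h'⟩ | ⟨h, h', h''⟩)
    · exact .inl ⟨h, h'⟩
    · exact .inr (.inl ⟨h, h'⟩)
    · exact .inr (.inr ⟨h, h', h''⟩)
  · rintro (⟨h, h'⟩ | ⟨h, h'⟩ | ⟨h, h', h''⟩)
    · exact .parLeft h h'
    · exact .parRight h h'
    · exact .par h h' h''

theorem hasTarget_add_iff {a : A} {n : ℕ} {p q : Proc A} :
    HasTarget a n (.add p q) ↔ HasTarget a n p ∨ HasTarget a n q :=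
  ⟨fun h => by cases h <;> tauto, fun h => h.elim (.addLeft _) (.addRight _)⟩

theorem Derivable.hasTarget_iff {E : Set (Equation A V)} {a : A} {n : ℕ} (hE : Sound E)
    (hsize : ∀ e ∈ E, e.1.size < n ∧ e.2.size < n) {t s : Term A V} (h : Derivable E t s) :
    ∀ σ : V → Proc A, Below a n (t.subst σ) →
      (HasTarget a n (t.subst σ) ↔ HasTarget a n (s.subst σ)) := by
  induction h with
  | ax h =>
    intro σ hb
    exact ⟨(hE _ _ h).hasTarget (hsize _ h).1 hb,
      SoundEquation.hasTarget (fun σ => (hE _ _ h σ).symm) (hsize _ h).2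
        (hb.rooted (hE _ _ h σ))⟩
  | refl t => exact fun _ _ => .rfl
  | symm h ih => exact fun σ hb => (ih σ (hb.rooted (h.soundEquation hE σ).symm)).symm
  | trans h₁ _ ih₁ ih₂ =>
    exact fun σ hb => (ih₁ σ hb).trans (ih₂ σ (hb.rooted (h₁.soundEquation hE σ)))
  | subst ρ _ ih =>
    intro σ hb
    rw [Term.subst_subst] at hb ⊢
    rw [Term.subst_subst]
    exact ih _ hb
  | pre μ _ _ => exact fun σ _ => ⟨nofun, nofun⟩
  | add _ _ ih₁ ih₂ =>
    intro σ hb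
    simp only [Term.subst, hasTarget_add_iff]
    exact or_congr (ih₁ σ (Below.addLeft hb)) (ih₂ σ (Below.addRight hb))
  | @par t s t' s' h h' ih₁ ih₂ =>
    intro σ hb
    have e := h.soundEquation hE σ
    have e' := h'.soundEquation hE σ
    have i : Inert (t.subst σ) ↔ Inert (s.subst σ) := ⟨e.inert, e.symm.inert⟩
    have i' : Inert (t'.subst σ) ↔ Inert (s'.subst σ) := ⟨e'.inert, e'.symm.inert⟩
    have ew := (e.par e').weakBisimilar
    -- The genuinely parallel alternative only involves inertness and weak bisimilarity of the
    -- whole, so congruence transports it without induction hypotheses.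
    simp only [Term.subst, hasTarget_par_iff, ← i, ← i']
    refine or_congr (and_congr_right fun hi => ih₁ σ (Below.parLeft hb hi.len_eq_zero))
      (or_congr (and_congr_right fun hi => ih₂ σ (Below.parRight hb hi.len_eq_zero))
        (and_congr_right fun _ => and_congr_right fun _ => ⟨ew.symm.trans, ew.trans⟩))

/-! ### The expansions of `a ∥ fan a n` -/

/-- The sum of the processes `a.(a ∥ stem a i)` for `i < n`. -/
def fanStep (a : A) : ℕ → Proc A
  | 0 => .nil
  | n + 1 => .add (fanStep a n) (.pre (act a) (.par (power a 1) (stem a n)))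

theorem step_fanStep_iff {a : A} {n : ℕ} {μ : Act A} {p : Proc A} :
    Step (fanStep a n) μ p ↔ μ = act a ∧ ∃ i < n, p = .par (power a 1) (stem a i) := by
  induction n with
  | zero =>
    constructor
    · rintro ⟨⟩
    · rintro ⟨-, i, hi, -⟩
      omega
  | succ n ih =>
    constructor
    · rintro (_ | ⟨_, h⟩ | ⟨_, _ | _⟩)
      · obtain ⟨h₁, i, hi, h₂⟩ := ih.1 h
        exact ⟨h₁, i, by omega, h₂⟩
      · exact ⟨rfl, n, by omega, rfl⟩
    · rintro ⟨rfl, i, hi, rfl⟩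
      rcases Nat.lt_succ_iff_lt_or_eq.1 hi with hi | rfl
      · exact .addLeft _ (ih.2 ⟨rfl, i, hi, rfl⟩)
      · exact .addRight _ (.pre _ _)

/-- The sum of the processes `a.p` for the derivatives `p` of `a ∥ fan a n`. -/
def expansion (a : A) (n : ℕ) : Proc A :=
  .add (.pre (act a) (.par .nil (fan a n))) (fanStep a n)

theorem step_expansion_iff {a : A} {n : ℕ} {μ : Act A} {p : Proc A} :
    Step (expansion a n) μ p ↔ Step (target a n) μ p := by
  rw [step_target_iff]
  constructor
  · rintro (_ | ⟨_, _ | _⟩ | ⟨_, h⟩)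
    · exact ⟨rfl, .inl rfl⟩
    · obtain ⟨h₁, h₂⟩ := step_fanStep_iff.1 h
      exact ⟨h₁, .inr h₂⟩
  · rintro ⟨rfl, rfl | h⟩
    · exact .addLeft _ (.pre _ _)
    · exact .addRight _ (step_fanStep_iff.2 ⟨rfl, h⟩)

theorem rootedWeakBisimilar_expansion (a : A) (n : ℕ) :
    RootedWeakBisimilar (target a n) (expansion a n) :=
  ⟨fun _ p h => ⟨p, (step_expansion_iff.2 h).strictWeakStep, .refl p⟩,
    fun _ p h => ⟨p, (step_expansion_iff.1 h).strictWeakStep, .refl p⟩⟩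

/-- All parallel compositions in the expansion are guarded by a prefix. -/
theorem not_hasTarget_expansion (a : A) (n m : ℕ) : ¬ HasTarget a m (expansion a n) := by
  have h : ¬ HasTarget a m (fanStep a n) := by
    induction n with
    | zero => exact nofun
    | succ n ih =>
      rw [fanStep, hasTarget_add_iff]
      rintro (h | h)
      · exact ih h
      · cases h
  rw [expansion, hasTarget_add_iff]
  rintro (h' | h')
  · cases h'
  · exact h h'

theorem below_target (a : A) (n : ℕ) : Below a n (target a n) := by
  intro μ p h
  obtain ⟨rfl, -⟩ := (pure_target a n).step h
  exact ⟨rfl, p, h, .refl p⟩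

theorem hasTarget_target (a : A) {n : ℕ} (hn : 0 < n) : HasTarget a n (target a n) :=
  .par (fun h => h _ _ (step_power_one_iff.2 ⟨rfl, rfl⟩))
    (fun h => h _ _ (step_fan_iff.2 ⟨rfl, 0, hn, rfl⟩)) (.refl _)

end CCS

/-- Rooted weak bisimilarity has no finite, sound and complete equational axiomatisation over the
recursion-, restriction- and relabelling-free fragment of CCS. -/
theorem mainTheorem1 {A : Type*} [Nonempty A] {V : Type*} [Countable V] [Infinite V] :
    ¬ ∃ E : Set (CCS.Equation A V), E.Finite ∧ CCS.Sound E ∧ CCS.Complete E := by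
  rintro ⟨E, hfin, hsound, hcomplete⟩
  obtain ⟨a⟩ := ‹Nonempty A›
  obtain ⟨N, hN⟩ := (hfin.image fun e => e.1.size + e.2.size).bddAbove
  have hsize : ∀ e ∈ E, e.1.size < N + 1 ∧ e.2.size < N + 1 := by
    intro e he
    have : e.1.size + e.2.size ≤ N := hN ⟨e, he, rfl⟩
    omega
  have hd : CCS.Derivable E (.ofProc (CCS.target a (N + 1))) (.ofProc (CCS.expansion a (N + 1))) :=
    hcomplete _ _ fun σ => by
      simpa only [CCS.Term.subst_ofProc] using CCS.rootedWeakBisimilar_expansion a (N + 1)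
  -- Both sides are closed, so any substitution serves.
  have hiff := hd.hasTarget_iff (a := a) hsound hsize fun _ => .nil
  simp only [CCS.Term.subst_ofProc] at hiff
  exact CCS.not_hasTarget_expansion a _ _
    ((hiff (CCS.below_target a _)).1 (CCS.hasTarget_target a N.succ_pos))
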